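/- Let $n\ge 2$. A parametrised smooth arc in $\mathbb P^n_{\mathbb C}$ is a power series $a=\sum_{j\ge0}a_jt^j$ with $a_j\in\mathbb C^{n+1}$ and $a_0\wedge a_1\ne0$. Let $\mathcal P$ be the set of these, with the Zariski topology defined by polynomials in finitely many of the coordinates of the $a_j$. The space $\mathcal A$ of smooth arcs is the quotient of $\mathcal P$, with the quotient topology, by multiplication of $a$ with invertible power series and by formal changes of parameter $t\mapsto\varphi(t)$, $\varphi(0)=0$, $\varphi'(0)\neq0$. The arc is non-inflexional if $a_0,\dots,a_n$ are linearly independent; its osculating hyperplane at $O=[a_0]$ is then the span of $a_0,\dots,a_{n-1}$, and its thick point of length $n+3$ (that is, $a$ modulo $t^{n+3}$) lies on a unique normal rational curve $\Gamma$ of degree $n$. The principal plane is the embedded Zariski tangent space at $O$ of the union of $\Gamma$ and the thick point of length $n+4$ of the arc; that is, if $a=\gamma+d\,t^{n+3}+O(t^{n+4})$ with $\gamma$ a power series that parametrises $\Gamma$ near $O$, it is the span of $a_0,a_1,d$. The Monge hypersurface $\mathcal M\subset\mathcal A$ is the closure of the set of non-inflexional arcs whose principal plane is contained in the osculating hyperplane.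 For a partition $\lambda=(\lambda_0\ge\dots\ge\lambda_n\ge 0)$ let $$U_\lambda(a)=\det(a_{\lambda_n},a_{\lambda_{n-1}+1},\dots,a_{\lambda_0+n}),\qquad U=U_\emptyset,$$ and omit zero parts and commas from the index. Theorem. In every dimension $n\ge2$ the equation of $\mathcal M$ is $$F:=U^2(U_3+2U_{21}+U_{111})-3UU_1(U_{11}+U_2)+2U_1^3=0 .$$ That is, the smooth arc represented by $a\in\mathcal P$ belongs to $\mathcal M$ if and only if $F(a)=0$, and a polynomial in the coordinates of the $a_j$ vanishes at all $a\in\mathcal P$ representing arcs of $\mathcal M$ if and only if it is divisible by $F$. -/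

import Mathlib

noncomputable section

namespace Monge

/-- A parametrised smooth arc in the `n`-dimensional complex projective space: a vector of
`n + 1` formal power series, `a = ∑ aⱼ tʲ` with `aⱼ ∈ ℂⁿ⁺¹`, such that `a₀ ∧ a₁ ≠ 0`. -/
structure ParamArc (n : ℕ) where
  /-- the homogeneous coordinates, as power series in the parameter -/
  series : Fin (n + 1) → PowerSeries ℂ
  smooth : LinearIndependent ℂ
    ![fun i => PowerSeries.coeff 0 (series i), fun i => PowerSeries.coeff 1 (series i)]

variable {n : ℕ}

/-- The `j`-th Taylor coefficient `aⱼ ∈ ℂⁿ⁺¹` of a parametrised arc. -/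
def ParamArc.vec (a : ParamArc n) (j : ℕ) : Fin (n + 1) → ℂ :=
  fun i => PowerSeries.coeff j (a.series i)

/-- The coordinate ring of the space `ℂⁿ⁺¹ ⊗ ℂ⟦t⟧`: polynomials in the coordinates `X (i, j)`,
where `X (i, j)` is the coefficient of `tʲ` in the `i`-th coordinate series. -/
abbrev CoordRing (n : ℕ) : Type := MvPolynomial (Fin (n + 1) × ℕ) ℂ

/-- The value of a polynomial function at a parametrised arc. -/
def ParamArc.eval (a : ParamArc n) (f : CoordRing n) : ℂ :=
  MvPolynomial.eval (fun p => a.vec p.2 p.1) f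

/-- The Zariski topology on the space of parametrised smooth arcs: the non-vanishing loci of
polynomial functions form a basis of open sets. -/
instance : TopologicalSpace (ParamArc n) :=
  TopologicalSpace.generateFrom
    (Set.range fun f : CoordRing n => {a : ParamArc n | a.eval f ≠ 0})

/-- `a` and `b` are in the same orbit of the group `G₀ ⋊ G₁`: `b = g · (a ∘ φ)` with `g` an
invertible power series and `φ` a formal change of parameter. -/
def SameArc (a b : ParamArc n) : Prop :=
  ∃ g φ : PowerSeries ℂ,
    PowerSeries.coeff 0 g ≠ 0 ∧ PowerSeries.coeff 0 φ = 0 ∧ PowerSeries.coeff 1 φ ≠ 0 ∧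
      ∀ i, b.series i = g * PowerSeries.subst φ (a.series i)

/-- The space of smooth arcs: the orbit space of the parametrised smooth arcs. -/
def Arc (n : ℕ) : Type := Quot (SameArc (n := n))

/-- The Zariski topology on the space of smooth arcs is the quotient topology. -/
instance : TopologicalSpace (Arc n) :=
  inferInstanceAs (TopologicalSpace (Quot (SameArc (n := n))))

/-- The smooth arc represented by a parametrised smooth arc. -/
def Arc.mk (a : ParamArc n) : Arc n := Quot.mk _ a

/-- An arc is non-inflexional when `a₀, …, aₙ` are linearly independent. -/
def ParamArc.NonInflexional (a : ParamArc n) : Prop :=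
  LinearIndependent ℂ fun j : Fin (n + 1) => a.vec j

/-- The (linear subspace of `ℂⁿ⁺¹` corresponding to the) osculating hyperplane of a
non-inflexional arc: the span of `a₀, …, aₙ₋₁`. -/
def ParamArc.osculatingHyperplane (a : ParamArc n) : Submodule ℂ (Fin (n + 1) → ℂ) :=
  Submodule.span ℂ {v | ∃ j < n, v = a.vec j}

/-- `Γ ⊆ ℂⁿ⁺¹` is the affine cone over a normal rational curve of degree `n`: the image of
`(s, t) ↦ (sⁿ, sⁿ⁻¹ t, …, tⁿ)` under an invertible linear map. -/
def IsNormalRationalCurve (Γ : Set (Fin (n + 1) → ℂ)) : Prop :=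
  ∃ A : Matrix.GeneralLinearGroup (Fin (n + 1)) ℂ,
    Γ = {x | ∃ s t : ℂ, x =
      Matrix.mulVec (A : Matrix (Fin (n + 1)) (Fin (n + 1)) ℂ)
        (fun i => s ^ (n - (i : ℕ)) * t ^ (i : ℕ))}

/-- The homogeneous form `F` vanishes on the thick point of length `r` of the arc `a`, that is
`F(a(t)) ≡ 0` modulo `tʳ`. -/
def ParamArc.VanishesToOrder (a : ParamArc n) (r : ℕ) (F : MvPolynomial (Fin (n + 1)) ℂ) : Prop :=
  (PowerSeries.X : PowerSeries ℂ) ^ r ∣ MvPolynomial.aeval a.series F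

/-- The thick point of length `r` of the arc is a closed subscheme of the projective curve with
affine cone `Γ`. -/
def ParamArc.ThickPointSubset (a : ParamArc n) (r : ℕ) (Γ : Set (Fin (n + 1) → ℂ)) : Prop :=
  ∀ (m : ℕ) (F : MvPolynomial (Fin (n + 1)) ℂ), F.IsHomogeneous m →
    F ∈ MvPolynomial.vanishingIdeal ℂ Γ → a.VanishesToOrder r F

/-- The principal plane at `O = [a₀]` of the arc `a` and the normal rational curve `Γ` that
contains its thick point of length `n + 3`: the embedded Zariski tangent space at `O` of the union
of `Γ` and the thick point of length `n + 4` of the arc (the first one which need not lie on `Γ`).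
It is given as a linear subspace of `ℂⁿ⁺¹`: the `v` annihilated by the differentials at `a₀` of all
homogeneous forms that vanish both on `Γ` and on that thick point. If the arc is
`a = γ + d tⁿ⁺³ + O(tⁿ⁺⁴)`, where `γ` parametrises `Γ`, it is the span of `a₀, a₁, d`. -/
def ParamArc.principalPlane (a : ParamArc n) (Γ : Set (Fin (n + 1) → ℂ)) :
    Submodule ℂ (Fin (n + 1) → ℂ) where
  carrier := {v | ∀ (m : ℕ) (F : MvPolynomial (Fin (n + 1)) ℂ), F.IsHomogeneous m →
    F ∈ MvPolynomial.vanishingIdeal ℂ Γ → a.VanishesToOrder (n + 4) F →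
      ∑ i, MvPolynomial.eval (a.vec 0) (MvPolynomial.pderiv i F) * v i = 0}
  add_mem' := by
    intro v w hv hw m F h1 h2 h3
    simp only [Pi.add_apply, mul_add, Finset.sum_add_distrib, hv m F h1 h2 h3, hw m F h1 h2 h3,
      add_zero]
  zero_mem' := by
    intro m F _ _ _
    simp
  smul_mem' := by
    intro c v hv m F h1 h2 h3
    have h := hv m F h1 h2 h3
    simp only [Pi.smul_apply, smul_eq_mul, mul_left_comm _ c, ← Finset.mul_sum, h, mul_zero]

/-- The Monge hypersurface: the closure, in the space of smooth arcs, of the set of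
non-inflexional arcs whose principal plane is contained in the osculating hyperplane. -/
def mongeHypersurface (n : ℕ) : Set (Arc n) :=
  closure {α | ∃ a : ParamArc n, Arc.mk a = α ∧ a.NonInflexional ∧
    ∃ Γ : Set (Fin (n + 1) → ℂ), IsNormalRationalCurve Γ ∧ a.ThickPointSubset (n + 3) Γ ∧
      a.principalPlane Γ ≤ a.osculatingHyperplane}

/-- The Plücker coordinate `U_λ = det (a_{λₙ}, a_{λₙ₋₁ + 1}, …, a_{λ₀ + n})` as a polynomial
function, where the partition `λ₀ ≥ λ₁ ≥ …` of length at most `n + 1` is given by the list of its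
non-zero parts. -/
def U (n : ℕ) (l : List ℕ) : CoordRing n :=
  Matrix.det (Matrix.of fun i j : Fin (n + 1) =>
    (MvPolynomial.X (i, l.getD (n - (j : ℕ)) 0 + (j : ℕ)) : CoordRing n))

/-- The Monge polynomial
`U² (U₃ + 2 U₂₁ + U₁₁₁) - 3 U U₁ (U₁₁ + U₂) + 2 U₁³`. -/
def mongePolynomial (n : ℕ) : CoordRing n :=
  U n [] ^ 2 * (U n [3] + 2 * U n [2, 1] + U n [1, 1, 1])
    - 3 * U n [] * U n [1] * (U n [1, 1] + U n [2]) + 2 * U n [1] ^ 3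

end Monge

end

/-! Write `F` for the Monge polynomial. The vector `a_{n+3}` enters `F` only through `U₃`, so `F` is
affine in it, with linear part `U² det(a₀, …, aₙ₋₁, ·)` (`mongeForm_eq_add`). Moreover `F` vanishes
on arcs of normal rational curves (`mongeForm_rationalArc`): projection from the span of the first
`n - 2` Taylor coefficients reduces this to conics. A non-inflexional arc `a` agrees modulo `tⁿ⁺³`
with an arc `γ` of such a curve (`exists_rationalArc`, by a residue computation). If `d` is the
difference in degree `n + 3`, then `F(a) = U² det(a₀, …, aₙ₋₁, d)`, so `F(a) = 0` exactly when `d`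
lies in the osculating hyperplane. This is the condition on the principal plane
(`mongeForm_eq_zero_of_principalPlane_le`, `exists_principalPlane_le`).

The same formula shows that the zero locus of `F` is a union of orbits
(`mongeForm_eq_zero_iff_of_sameArc`): the group moves `γ` to another arc of the same curve and
rescales `d`, and where `U = 0` only `2 U₁³` remains.

For the closure and the ideal, `F` has degree one in a coordinate of `a_{n+3}` and is prime to the
coefficient of that coordinate. Hence a polynomial that vanishes where `F = 0` and `U ≠ 0` is a
multiple of `F` (`mongePolynomial_dvd`), and the non-inflexional arcs are dense in `F = 0`. -/

noncomputable section

namespace Monge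

/-! ### Plücker coordinates and the shape of the Monge polynomial. -/

section Determinants

variable {R S : Type*} [CommRing R] [CommRing S] {n : ℕ}

/-- The Plücker coordinate with index `l` of a sequence of vectors. -/
def pluecker (v : ℕ → Fin (n + 1) → R) (l : List ℕ) : R :=
  Matrix.det (Matrix.of fun i j : Fin (n + 1) => v (l.getD (n - (j : ℕ)) 0 + (j : ℕ)) i)

/-- The Monge polynomial, evaluated at a sequence of vectors. -/
def mongeForm (v : ℕ → Fin (n + 1) → R) : R :=
  pluecker v [] ^ 2 * (pluecker v [3] + 2 * pluecker v [2, 1] + pluecker v [1, 1, 1])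
    - 3 * pluecker v [] * pluecker v [1] * (pluecker v [1, 1] + pluecker v [2])
    + 2 * pluecker v [1] ^ 3

/-- The linear form `x ↦ det (v₀, …, vₙ₋₁, x)`. -/
def lastMinor (v : ℕ → Fin (n + 1) → R) : (Fin (n + 1) → R) →ₗ[R] R :=
  LinearMap.proj (Fin.last n) ∘ₗ Matrix.cramer (Matrix.of fun i j : Fin (n + 1) => v j i)

lemma lastMinor_apply (v : ℕ → Fin (n + 1) → R) (x : Fin (n + 1) → R) :
    lastMinor v x = Matrix.det (Matrix.of fun i j : Fin (n + 1) =>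
      if (j : ℕ) = n then x i else v j i) := by
  rw [lastMinor, LinearMap.comp_apply, LinearMap.proj_apply, Matrix.cramer_apply]
  congr 1
  ext i j
  by_cases h : j = Fin.last n
  · subst h; simp
  · have : (j : ℕ) ≠ n := fun h' => h (Fin.ext h')
    simp [h, this]

lemma pluecker_map (σ : R →+* S) (v : ℕ → Fin (n + 1) → R) (l : List ℕ) :
    σ (pluecker v l) = pluecker (fun j i => σ (v j i)) l := by
  rw [pluecker, RingHom.map_det]
  rfl

lemma mongeForm_map (σ : R →+* S) (v : ℕ → Fin (n + 1) → R) :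
    σ (mongeForm v) = mongeForm (fun j i => σ (v j i)) := by
  simp only [mongeForm, map_add, map_sub, map_mul, map_pow, pluecker_map, map_ofNat]

lemma lastMinor_map (σ : R →+* S) (v : ℕ → Fin (n + 1) → R) (x : Fin (n + 1) → R) :
    σ (lastMinor v x) = lastMinor (fun j i => σ (v j i)) (fun i => σ (x i)) := by
  rw [lastMinor_apply, lastMinor_apply, RingHom.map_det]
  congr 1
  ext i j
  simp only [RingHom.mapMatrix_apply, Matrix.map_apply, Matrix.of_apply]
  split_ifs <;> rfl

lemma pluecker_mulVec (A : Matrix (Fin (n + 1)) (Fin (n + 1)) R) (v : ℕ → Fin (n + 1) → R)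
    (l : List ℕ) : pluecker (fun j => A.mulVec (v j)) l = A.det * pluecker v l := by
  rw [pluecker, pluecker, ← Matrix.det_mul]
  rfl

lemma mongeForm_mulVec (A : Matrix (Fin (n + 1)) (Fin (n + 1)) R) (v : ℕ → Fin (n + 1) → R) :
    mongeForm (fun j => A.mulVec (v j)) = A.det ^ 3 * mongeForm v := by
  simp only [mongeForm, pluecker_mulVec]
  ring

lemma lastMinor_mulVec (A : Matrix (Fin (n + 1)) (Fin (n + 1)) R) (v : ℕ → Fin (n + 1) → R)
    (x : Fin (n + 1) → R) :
    lastMinor (fun j => A.mulVec (v j)) (A.mulVec x) = A.det * lastMinor v x := by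
  rw [lastMinor_apply, lastMinor_apply, ← Matrix.det_mul]
  congr 1
  ext i j
  simp only [Matrix.mul_apply, Matrix.of_apply]
  split_ifs <;> rfl

lemma pluecker_congr {v w : ℕ → Fin (n + 1) → R} {l : List ℕ}
    (h : ∀ j ≤ n, v (l.getD (n - j) 0 + j) = w (l.getD (n - j) 0 + j)) :
    pluecker v l = pluecker w l := by
  rw [pluecker, pluecker]
  congr 1
  ext i j
  exact congrFun (h j (Nat.lt_succ_iff.1 j.2)) i

lemma lastMinor_congr {v w : ℕ → Fin (n + 1) → R} (h : ∀ j < n, v j = w j) :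
    lastMinor v = lastMinor w := by
  ext1
  ext1
  simp only [LinearMap.comp_apply, lastMinor_apply]
  congr 1
  ext i j
  simp only [Matrix.of_apply]
  split_ifs with hj
  · rfl
  · exact congrFun (h j (by omega)) i

lemma lastMinor_apply_of_lt (v : ℕ → Fin (n + 1) → R) {j : ℕ} (hj : j < n) :
    lastMinor v (v j) = 0 := by
  rw [lastMinor_apply]
  refine Matrix.det_zero_of_column_eq (i := ⟨j, by omega⟩) (j := Fin.last n)
    (by simp [Fin.ext_iff, hj.ne]) fun k => ?_
  simp [hj.ne]

lemma pluecker_singleton (v : ℕ → Fin (n + 1) → R) (k : ℕ) :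
    pluecker v [k] = lastMinor v (v (n + k)) := by
  rw [pluecker, lastMinor_apply]
  congr 1
  ext i j
  simp only [Matrix.of_apply]
  split_ifs with h
  · simp [h, add_comm]
  · obtain ⟨d, hd⟩ : ∃ d, n - (j : ℕ) = d + 1 := ⟨n - j - 1, by omega⟩
    simp [hd]

lemma pluecker_nil (v : ℕ → Fin (n + 1) → R) : pluecker v [] = lastMinor v (v n) := by
  rw [show v n = v (n + 0) from rfl, ← pluecker_singleton, pluecker, pluecker]
  congr 1
  ext i j
  simp only [Matrix.of_apply]
  rcases n - (j : ℕ) <;> simp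

lemma pluecker_nil' (v : ℕ → Fin (n + 1) → R) :
    pluecker v [] = Matrix.det (Matrix.of fun i j : Fin (n + 1) => v j i) := by
  simp [pluecker]

/-- The last column of `U_λ` has index `n + λ₀`, and the other columns stay below `n + 3` for the
partitions in question. So only `U₃` sees the vector of index `n + 3`, linearly and with coefficient
`U²`. -/
lemma mongeForm_eq_add {v w : ℕ → Fin (n + 1) → R} (h : ∀ j < n + 3, w j = v j) :
    mongeForm w = mongeForm v + pluecker v [] ^ 2 * lastMinor v (w (n + 3) - v (n + 3)) := by
  have key : ∀ l : List ℕ, l.getD 0 0 ≤ 2 → l.getD 1 0 ≤ 2 → l.getD 2 0 ≤ 2 →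
      (∀ k, l.getD (k + 3) 0 = 0) → pluecker w l = pluecker v l := by
    intro l h0 h1 h2 h3
    refine pluecker_congr fun j hj => h _ ?_
    rcases hd : n - j with _ | _ | _ | d
    · omega
    · simp only [zero_add]; omega
    · rw [show 0 + 1 + 1 = 2 from rfl]; omega
    · rw [show d + 1 + 1 + 1 = d + 3 from rfl, h3]; omega
  have e0 : pluecker w [] = pluecker v [] := key _ (by simp) (by simp) (by simp) (by simp)
  have e1 : pluecker w [1] = pluecker v [1] := key _ (by simp) (by simp) (by simp) (by simp)
  have e2 : pluecker w [2] = pluecker v [2] := key _ (by simp) (by simp) (by simp) (by simp)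
  have e11 : pluecker w [1, 1] = pluecker v [1, 1] :=
    key _ (by simp) (by simp) (by simp) (by simp)
  have e21 : pluecker w [2, 1] = pluecker v [2, 1] :=
    key _ (by simp) (by simp) (by simp) (by simp)
  have e111 : pluecker w [1, 1, 1] = pluecker v [1, 1, 1] :=
    key _ (by simp) (by simp) (by simp) (by simp)
  have e3 : pluecker w [3] = pluecker v [3] + lastMinor v (w (n + 3) - v (n + 3)) := by
    rw [pluecker_singleton, pluecker_singleton, map_sub,
      lastMinor_congr fun j hj => h j (by omega)]
    ring
  simp only [mongeForm, e0, e1, e2, e11, e21, e111, e3]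
  ring

/-- Projection from `⟨v₀, …, vₘ₋₁⟩`: if these vectors have no coordinates of index `≥ m`, the
Plücker coordinates of length at most three reduce to those of the last three coordinates. -/
lemma pluecker_of_triangular {m : ℕ} {v : ℕ → Fin (m + 2 + 1) → R}
    (h : ∀ j < m, ∀ i : Fin (m + 2 + 1), m ≤ (i : ℕ) → v j i = 0) {l : List ℕ}
    (hl : ∀ k, l.getD (k + 3) 0 = 0) :
    pluecker v l = Matrix.det (Matrix.of fun i j : Fin m => v j (i.castAdd 3)) *
      pluecker (n := 2) (fun j i => v (m + j) (i.natAdd m)) l := by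
  rw [pluecker, ← Matrix.det_reindex_self (finSumFinEquiv (m := m) (n := 3)).symm]
  have : (Matrix.reindex (finSumFinEquiv (m := m) (n := 3)).symm
      (finSumFinEquiv (m := m) (n := 3)).symm
      (Matrix.of fun i j : Fin (m + 2 + 1) => v (l.getD (m + 2 - (j : ℕ)) 0 + (j : ℕ)) i)) =
      Matrix.fromBlocks (Matrix.of fun i j : Fin m => v j (i.castAdd 3))
        (Matrix.of fun (i : Fin m) (j : Fin 3) =>
          v (l.getD (2 - (j : ℕ)) 0 + (m + (j : ℕ))) (i.castAdd 3)) 0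
        (Matrix.of fun (i j : Fin 3) =>
          v (m + (l.getD (2 - (j : ℕ)) 0 + (j : ℕ))) (i.natAdd m)) := by
    -- At most three parts are non-zero, so only the last three columns are shifted.
    have e1 : ∀ j : Fin m, l.getD (m + 2 - (j : ℕ)) 0 = 0 := fun j => by
      rw [show m + 2 - (j : ℕ) = (m - 1 - j) + 3 by omega, hl]
    have e2 : ∀ j : Fin 3, m + 2 - (m + (j : ℕ)) = 2 - j := fun j => by omega
    ext (i | i) (j | j)
    · simp [e1, -List.getD_eq_getElem?_getD]
    · simp [e2, -List.getD_eq_getElem?_getD]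
    · simpa [e1, -List.getD_eq_getElem?_getD] using h j j.2 (i.natAdd m) (by simp)
    · simp [e2, add_left_comm, -List.getD_eq_getElem?_getD]
  rw [this, Matrix.det_fromBlocks_zero₂₁]
  rfl

/-- All the Plücker coordinates involved acquire the same factor, and the form is a homogeneous
cubic in them. This is the reduction to the plane. -/
lemma mongeForm_of_triangular {m : ℕ} {v : ℕ → Fin (m + 2 + 1) → R}
    (h : ∀ j < m, ∀ i : Fin (m + 2 + 1), m ≤ (i : ℕ) → v j i = 0) :
    mongeForm v = Matrix.det (Matrix.of fun i j : Fin m => v j (i.castAdd 3)) ^ 3 *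
      mongeForm (n := 2) (fun j i => v (m + j) (i.natAdd m)) := by
  have key := fun l => pluecker_of_triangular (l := l) h
  rw [mongeForm, key [] (by simp), key [1] (by simp), key [2] (by simp), key [3] (by simp),
    key [1, 1] (by simp), key [2, 1] (by simp), key [1, 1, 1] (by simp), mongeForm]
  ring

end Determinants

/-! ### Vanishing on normal rational curves, and a residue identity. -/

section RationalCurves

open PowerSeries

variable {n : ℕ}

/-- The sequence of Taylor coefficients of a vector of power series. -/
def taylor (x : Fin (n + 1) → ℂ⟦X⟧) (j : ℕ) (i : Fin (n + 1)) : ℂ := coeff j (x i)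

/-- The arc `g · A (1, φ, …, φⁿ)` on a normal rational curve. -/
def rationalArc (A : Matrix (Fin (n + 1)) (Fin (n + 1)) ℂ) (g φ : ℂ⟦X⟧) (i : Fin (n + 1)) :
    ℂ⟦X⟧ :=
  ∑ k, C (A i k) * (g * φ ^ (k : ℕ))

/-- The Taylor coefficients of the arc `g · (1, φ, …, φⁿ)`. -/
def standardTaylor (n : ℕ) (g φ : ℂ⟦X⟧) (j : ℕ) (k : Fin (n + 1)) : ℂ :=
  coeff j (g * φ ^ (k : ℕ))

lemma taylor_rationalArc (A : Matrix (Fin (n + 1)) (Fin (n + 1)) ℂ) (g φ : ℂ⟦X⟧) :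
    taylor (rationalArc A g φ) = fun j => A.mulVec (standardTaylor n g φ j) := by
  ext j i
  simp [taylor, rationalArc, standardTaylor, Matrix.mulVec, dotProduct]

lemma coeff_mul_X_mul_pow (g ψ : ℂ⟦X⟧) (j k : ℕ) :
    coeff j (g * (X * ψ) ^ k) = if k ≤ j then coeff (j - k) (g * ψ ^ k) else 0 := by
  rw [mul_pow, mul_left_comm, coeff_X_pow_mul']

/-- The arc `P · (1, tψ, t²ψ²)` lies on a conic. For an arc `(1, t, y)` the form is, up to a
constant factor, Monge's differential equation of conics; here it is checked as an identity in the
low-order coefficients. -/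
lemma mongeForm_conic (P ψ : ℂ⟦X⟧) :
    mongeForm (n := 2) (fun j i => if (i : ℕ) ≤ j then coeff (j - i) (P * ψ ^ (i : ℕ)) else 0)
      = 0 := by
  have c0 : ∀ f h : ℂ⟦X⟧, coeff 0 (f * h) = coeff 0 f * coeff 0 h := fun f h => by
    simp
  have c1 : ∀ f h : ℂ⟦X⟧, coeff 1 (f * h) = coeff 0 f * coeff 1 h + coeff 1 f * coeff 0 h :=
    fun f h => by
      rw [coeff_mul, Finset.Nat.sum_antidiagonal_eq_sum_range_succ_mk]
      simp [Finset.sum_range_succ]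
  have c2 : ∀ f h : ℂ⟦X⟧, coeff 2 (f * h) =
      coeff 0 f * coeff 2 h + coeff 1 f * coeff 1 h + coeff 2 f * coeff 0 h := fun f h => by
    rw [coeff_mul, Finset.Nat.sum_antidiagonal_eq_sum_range_succ_mk]
    simp [Finset.sum_range_succ]
  have c3 : ∀ f h : ℂ⟦X⟧, coeff 3 (f * h) =
      coeff 0 f * coeff 3 h + coeff 1 f * coeff 2 h + coeff 2 f * coeff 1 h +
        coeff 3 f * coeff 0 h := fun f h => by
    rw [coeff_mul, Finset.Nat.sum_antidiagonal_eq_sum_range_succ_mk]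
    simp [Finset.sum_range_succ]
  simp only [mongeForm, pluecker, Matrix.det_fin_three, Matrix.of_apply, Fin.isValue,
    Fin.coe_ofNat_eq_mod, Nat.zero_mod, Nat.one_mod, Nat.reduceMod, Nat.reduceSub,
    List.getD_cons_zero, List.getD_cons_succ, List.getD_nil, Nat.reduceAdd, Nat.reduceLeDiff,
    if_true, if_false, pow_zero, pow_one, mul_one, pow_two ψ, c0, c1, c2, c3, add_zero, zero_add,
    nonpos_iff_eq_zero, OfNat.ofNat_ne_zero, one_ne_zero, le_refl, zero_le]
  ring

/-- With `φ = tψ` and `m = n - 2`, the last three coordinates are `tᵐ gψᵐ · (1, φ, φ²)`. Shifting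
the Taylor coefficients by `m` gives an arc of a conic. -/
lemma mongeForm_standardTaylor_X_mul (hn : 2 ≤ n) (g ψ : ℂ⟦X⟧) :
    mongeForm (standardTaylor n g (X * ψ)) = 0 := by
  obtain ⟨m, rfl⟩ := Nat.exists_eq_add_of_le' hn
  rw [mongeForm_of_triangular]
  · have : (fun (j : ℕ) (i : Fin (2 + 1)) =>
        standardTaylor (m + 2) g (X * ψ) (m + j) (i.natAdd m)) =
          fun (j : ℕ) (i : Fin (2 + 1)) =>
          if (i : ℕ) ≤ j then coeff (j - i) (g * ψ ^ m * ψ ^ (i : ℕ)) else 0 := by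
      ext j i
      rw [standardTaylor, coeff_mul_X_mul_pow]
      simp only [Fin.val_natAdd, add_le_add_iff_left, Nat.add_sub_add_left, pow_add, mul_assoc]
    rw [this, mongeForm_conic, mul_zero]
  · intro j hj i hi
    rw [standardTaylor, coeff_mul_X_mul_pow, if_neg (by omega)]

lemma rationalArc_C_add (A : Matrix (Fin (n + 1)) (Fin (n + 1)) ℂ) (g φ : ℂ⟦X⟧) (c : ℂ) :
    rationalArc A g (φ + C c) =
      rationalArc (A * Matrix.of fun k l : Fin (n + 1) =>
        c ^ ((k : ℕ) - l) * ((k : ℕ).choose l : ℂ)) g φ := by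
  ext1 i
  simp only [rationalArc, Matrix.mul_apply, Matrix.of_apply, map_sum, Finset.sum_mul]
  rw [Finset.sum_comm]
  refine Finset.sum_congr rfl fun k _ => ?_
  have : (φ + C c) ^ (k : ℕ) = ∑ l : Fin (n + 1),
      φ ^ (l : ℕ) * C c ^ ((k : ℕ) - l) * ((k : ℕ).choose l : ℂ⟦X⟧) := by
    rw [add_pow, Fin.sum_univ_eq_sum_range
      (fun l => φ ^ l * C c ^ ((k : ℕ) - l) * ((k : ℕ).choose l : ℂ⟦X⟧)) (n + 1)]
    -- For `l > k` the binomial coefficient is zero, so the truncated exponent `k - l` does no harm.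
    refine Finset.sum_subset (Finset.range_subset_range.2 (by omega)) fun l _ hl => ?_
    rw [Nat.choose_eq_zero_of_lt (by simpa using hl)]
    simp
  rw [this, Finset.mul_sum, Finset.mul_sum]
  refine Finset.sum_congr rfl fun l _ => ?_
  simp only [map_mul, map_pow, map_natCast]
  ring

/-- The Monge polynomial vanishes on arcs of normal rational curves. -/
theorem mongeForm_rationalArc (hn : 2 ≤ n) (A : Matrix (Fin (n + 1)) (Fin (n + 1)) ℂ)
    (g φ : ℂ⟦X⟧) : mongeForm (taylor (rationalArc A g φ)) = 0 := by
  obtain ⟨ψ, c, rfl⟩ : ∃ (ψ : ℂ⟦X⟧) (c : ℂ), φ = X * ψ + C c :=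
    ⟨_, _, eq_X_mul_shift_add_const φ⟩
  rw [rationalArc_C_add, taylor_rationalArc, mongeForm_mulVec, mongeForm_standardTaylor_X_mul hn,
    mul_zero]

/-- `φ' (t / φ)ᴺ` has no term of degree `N - 1` when `N ≥ 2`: the residue of the derivative of
`φ¹⁻ᴺ / (1 - N)` vanishes. -/
lemma coeff_derivative_mul_pow {ψ χ : ℂ⟦X⟧} (h : ψ * χ = 1) (N : ℕ) :
    coeff (N + 1) (derivative ℂ (X * ψ) * χ ^ (N + 2)) = 0 := by
  have h1 : derivative ℂ (X * ψ) * χ ^ (N + 2) =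
      χ ^ (N + 1) + X * (derivative ℂ ψ * χ ^ (N + 2)) := by
    rw [Derivation.leibniz]
    simp only [derivative_X, smul_eq_mul]
    linear_combination (χ ^ (N + 1)) * h
  have h2 : derivative ℂ (χ ^ (N + 1)) =
      -((N + 1 : ℕ) : ℂ⟦X⟧) * (derivative ℂ ψ * χ ^ (N + 2)) := by
    have h3 : ψ * derivative ℂ χ + χ * derivative ℂ ψ = 0 := by
      have := congrArg (derivative ℂ) h
      simpa [Derivation.leibniz] using this
    rw [Derivation.leibniz_pow]
    simp only [nsmul_eq_mul, smul_eq_mul, Nat.add_sub_cancel]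
    linear_combination (((N + 1 : ℕ) : ℂ⟦X⟧) * χ ^ (N + 1)) * h3 -
      (((N + 1 : ℕ) : ℂ⟦X⟧) * χ ^ N * derivative ℂ χ) * h
  -- In degree `N` this relates the coefficient of order `N + 1` of `χ ^ (N + 1)` to the second term
  -- of `h1`; the two contributions cancel.
  have h4 := congrArg (coeff N) h2
  rw [coeff_derivative, neg_mul, map_neg, ← map_natCast (C (R := ℂ)), coeff_C_mul] at h4
  rw [h1, map_add, coeff_succ_X_mul]
  have : ((N + 1 : ℕ) : ℂ) ≠ 0 := by exact_mod_cast Nat.succ_ne_zero N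
  apply mul_left_cancel₀ this
  push_cast at h4 ⊢
  linear_combination h4

end RationalCurves

/-! ### The osculating normal rational curve. -/

section Osculation

open PowerSeries

variable {n : ℕ}

/-- With `φ = tψ`, this is the residue of `φ' φ^(s - n - 3)`. It vanishes because the exponent is at
most `-2`, so that the expression is a derivative. -/
lemma coeff_residue {ψ χ : ℂ⟦X⟧} (h : ψ * χ = 1) {s : ℕ} (hs : s ≤ n + 1) :
    coeff (n + 2) (derivative ℂ (X * ψ) * χ ^ (n + 3) * (X * ψ) ^ s) = 0 := by
  obtain ⟨N, hN⟩ : ∃ N, n + 1 = s + N := ⟨n + 1 - s, by omega⟩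
  have : derivative ℂ (X * ψ) * χ ^ (n + 3) * (X * ψ) ^ s =
      X ^ s * (derivative ℂ (X * ψ) * χ ^ (N + 2)) := by
    rw [show n + 3 = s + (N + 2) by omega, pow_add, mul_pow]
    have h1 : ψ ^ s * χ ^ s = 1 := by rw [← mul_pow, h, one_pow]
    linear_combination (derivative ℂ (X * ψ) * χ ^ (N + 2) * X ^ s) * h1
  rw [this, show n + 2 = (N + 1) + s by omega, coeff_X_pow_mul]
  exact coeff_derivative_mul_pow h N

lemma det_standardTaylor_ne_zero {g ψ : ℂ⟦X⟧} (hg : coeff 0 g ≠ 0) (hψ : coeff 0 ψ ≠ 0) :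
    Matrix.det (Matrix.of fun i j : Fin (n + 1) => standardTaylor n g (X * ψ) j i) ≠ 0 := by
  rw [Matrix.det_of_isUpperTriangular]
  · refine Finset.prod_ne_zero_iff.2 fun i _ => ?_
    simp only [coeff_zero_eq_constantCoeff] at hg hψ
    simp [standardTaylor, coeff_mul_X_mul_pow, hg, hψ]
  · intro i j hij
    have : (j : ℕ) < i := hij
    simp only [Matrix.of_apply, standardTaylor, coeff_mul_X_mul_pow]
    rw [if_neg (by omega)]

/-- The relations between the first Taylor coefficients of an arc, as power series. -/
def relationSeries (n : ℕ) (p : Fin (n + 1) → ℂ) : ℂ⟦X⟧ :=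
  ∑ j : Fin (n + 1), C (p j) * X ^ (n + 1 - (j : ℕ))

lemma constantCoeff_relationSeries (p : Fin (n + 1) → ℂ) :
    constantCoeff (relationSeries n p) = 0 := by
  rw [relationSeries, map_sum]
  refine Finset.sum_eq_zero fun j _ => ?_
  rw [map_mul, map_pow, constantCoeff_X, zero_pow (by omega), mul_zero]

/-- This turns a linear relation between Taylor coefficients into the vanishing of a single
coefficient of a product, to which residues apply. -/
lemma coeff_mul_X_mul_relationSeries (p : Fin (n + 1) → ℂ) (f : ℂ⟦X⟧) :
    coeff (n + 2) (f * (X * relationSeries n p)) = ∑ j : Fin (n + 1), p j * coeff j f := by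
  rw [relationSeries, Finset.mul_sum, Finset.mul_sum, map_sum]
  refine Finset.sum_congr rfl fun j _ => ?_
  rw [show f * (X * (C (p j) * X ^ (n + 1 - (j : ℕ)))) =
    C (p j) * (f * X ^ (n + 2 - (j : ℕ))) by
      rw [show n + 2 - (j : ℕ) = n + 1 - j + 1 by omega, pow_succ]; ring, coeff_C_mul,
    show n + 2 = (j : ℕ) + (n + 2 - j) by omega, Nat.add_sub_cancel_left, coeff_mul_X_pow]

/-- Gale duality: there are arcs `g · (1, φ, …, φⁿ)` with prescribed linear relations between the
Taylor coefficients of order at most `n + 2`. -/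
lemma exists_standardTaylor_eq (p q : Fin (n + 1) → ℂ) :
    ∃ g ψ : ℂ⟦X⟧, coeff 0 g ≠ 0 ∧ coeff 0 ψ ≠ 0 ∧
      standardTaylor n g (X * ψ) (n + 1) = ∑ j, p j • standardTaylor n g (X * ψ) j ∧
      standardTaylor n g (X * ψ) (n + 2) = ∑ j, q j • standardTaylor n g (X * ψ) j := by
  -- For `f = g φⁱ`, the two relations say that `f · t w'` and `f · w` have no term of degree `n +
  -- 2`. Take `φ = t w' / w` and `g = φ' (t/φ)ⁿ⁺³ / w`: the products become `φ' (t/φ)ⁿ⁺³` times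
  -- `φⁱ⁺¹` and `φⁱ`, and `coeff_residue` applies to both.
  set w : ℂ⟦X⟧ := 1 - X * relationSeries n q with hw
  set w' : ℂ⟦X⟧ := 1 - relationSeries n p with hw'
  have hw0 : constantCoeff w = 1 := by simp [hw]
  have hw'0 : constantCoeff w' = 1 := by simp [hw', constantCoeff_relationSeries]
  set u := w⁻¹ with hu
  have hwu : w * u = 1 := PowerSeries.mul_inv_cancel _ (by simp [hw0])
  have hu0 : constantCoeff u = 1 := by simp [hu, hw0]
  set ψ := w' * u with hψ
  have hψ0 : constantCoeff ψ = 1 := by simp [hψ, hu0, hw'0]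
  set χ := ψ⁻¹
  have hχ : ψ * χ = 1 := PowerSeries.mul_inv_cancel _ (by simp [hψ0])
  have hχ0 : constantCoeff χ = 1 := by simp [χ, hψ0]
  refine ⟨derivative ℂ (X * ψ) * χ ^ (n + 3) * u, ψ, ?_, by simp [hψ0], ?_, ?_⟩
  · simp [hχ0, hu0, hψ0, Derivation.leibniz]
  · ext i
    set f := derivative ℂ (X * ψ) * χ ^ (n + 3) * u * (X * ψ) ^ (i : ℕ) with hf
    have h1 : f * (X * w') = derivative ℂ (X * ψ) * χ ^ (n + 3) * (X * ψ) ^ ((i : ℕ) + 1) := by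
      rw [hf, pow_succ, show X * ψ = u * (X * w') by rw [hψ]; ring]
      ring
    have h2 := coeff_residue (n := n) hχ (s := i + 1) (by omega)
    rw [← h1, hw', mul_sub, mul_sub, map_sub, coeff_mul_X_mul_relationSeries, mul_one,
      coeff_succ_mul_X, sub_eq_zero] at h2
    simp only [standardTaylor, Finset.sum_apply, Pi.smul_apply, smul_eq_mul]
    exact h2
  · ext i
    set f := derivative ℂ (X * ψ) * χ ^ (n + 3) * u * (X * ψ) ^ (i : ℕ) with hf
    have h1 : f * w = derivative ℂ (X * ψ) * χ ^ (n + 3) * (X * ψ) ^ (i : ℕ) := by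
      rw [hf]
      linear_combination (derivative ℂ (X * ψ) * χ ^ (n + 3) * (X * ψ) ^ (i : ℕ)) * hwu
    have h2 := coeff_residue (n := n) hχ (s := i) (by omega)
    rw [← h1, hw, mul_sub, map_sub, coeff_mul_X_mul_relationSeries, mul_one, sub_eq_zero] at h2
    simp only [standardTaylor, Finset.sum_apply, Pi.smul_apply, smul_eq_mul]
    exact h2

/-- An arc with `a₀, …, aₙ` independent agrees modulo `tⁿ⁺³` with an arc of a normal rational
curve. -/
theorem exists_rationalArc {v : ℕ → Fin (n + 1) → ℂ} (hv : pluecker v [] ≠ 0) :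
    ∃ (A : Matrix (Fin (n + 1)) (Fin (n + 1)) ℂ) (g ψ : ℂ⟦X⟧), A.det ≠ 0 ∧ coeff 0 g ≠ 0 ∧
      coeff 0 ψ ≠ 0 ∧ ∀ j < n + 3, v j = taylor (rationalArc A g (X * ψ)) j := by
  rw [pluecker_nil'] at hv
  set M : Matrix (Fin (n + 1)) (Fin (n + 1)) ℂ := Matrix.of fun i j => v j i with hM
  have hM1 : M * M⁻¹ = 1 := Matrix.mul_nonsing_inv _ hv.isUnit
  have hMcol : ∀ p : Fin (n + 1) → ℂ, M.mulVec p = ∑ j : Fin (n + 1), p j • v j := fun p => by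
    ext i
    simp [Matrix.mulVec, dotProduct, hM, mul_comm]
  have hsol : ∀ x, ∑ j : Fin (n + 1), (M⁻¹.mulVec x) j • v j = x := fun x => by
    rw [← hMcol, Matrix.mulVec_mulVec, hM1, Matrix.one_mulVec]
  -- The prescribed relations are the coordinates of `v (n + 1)` and `v (n + 2)` in the basis `v 0,
  -- …, v n`. A linear map that matches the two bases then matches the next two vectors as well.
  obtain ⟨g, ψ, hg, hψ, h1, h2⟩ :=
    exists_standardTaylor_eq (M⁻¹.mulVec (v (n + 1))) (M⁻¹.mulVec (v (n + 2)))
  have hN := det_standardTaylor_ne_zero (n := n) hg hψ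
  set N : Matrix (Fin (n + 1)) (Fin (n + 1)) ℂ :=
    Matrix.of fun i j => standardTaylor n g (X * ψ) j i with hNdef
  have hA : ∀ j : Fin (n + 1), (M * N⁻¹).mulVec (standardTaylor n g (X * ψ) j) = v j :=
      fun j => by
    have e1 : standardTaylor n g (X * ψ) j = N.mulVec (Pi.single j 1) := by
      ext i; simp [hNdef]
    have e2 : v j = M.mulVec (Pi.single j 1) := by
      ext i; simp [hM]
    rw [e1, e2, Matrix.mulVec_mulVec, Matrix.mul_assoc, Matrix.nonsing_inv_mul _ hN.isUnit,
      Matrix.mul_one]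
  refine ⟨M * N⁻¹, g, ψ, ?_, hg, hψ, fun j hj => ?_⟩
  · rw [Matrix.det_mul, Matrix.det_nonsing_inv, Ring.inverse_eq_inv']
    exact mul_ne_zero hv (inv_ne_zero hN)
  · rw [taylor_rationalArc]
    obtain hj | rfl | rfl : j < n + 1 ∨ j = n + 1 ∨ j = n + 2 := by omega
    · exact (hA ⟨j, hj⟩).symm
    · simp only [h1, Matrix.mulVec_sum, Matrix.mulVec_smul, hA, hsol]
    · simp only [h2, Matrix.mulVec_sum, Matrix.mulVec_smul, hA, hsol]

end Osculation

/-! ### Invariance under rescaling and change of parameter. -/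

section Invariance

open PowerSeries

variable {n : ℕ}

/-- The group acts on Taylor coefficients by a triangular matrix; `coeff_mul_pow_self` gives its
diagonal. -/
lemma coeff_mul_subst {φ : ℂ⟦X⟧} (hφ : constantCoeff φ = 0) (g f : ℂ⟦X⟧) (j : ℕ) :
    coeff j (g * subst φ f) = ∑ k ∈ Finset.range (j + 1), coeff j (g * φ ^ k) * coeff k f := by
  have hs : HasSubst φ := HasSubst.of_constantCoeff_zero' hφ
  obtain ⟨h, hh⟩ : ∃ h, f = X ^ (j + 1) * h + (trunc (j + 1) f : ℂ⟦X⟧) :=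
    ⟨_, eq_X_pow_mul_shift_add_trunc (j + 1) f⟩
  have h1 : coeff j (g * subst φ (X ^ (j + 1) * h)) = 0 := by
    rw [subst_mul hs, subst_pow hs, subst_X hs]
    have : (X : ℂ⟦X⟧) ^ (j + 1) ∣ g * (φ ^ (j + 1) * subst φ h) :=
      dvd_mul_of_dvd_right (dvd_mul_of_dvd_left (pow_dvd_pow_of_dvd (X_dvd_iff.2 hφ) _) _) _
    exact X_pow_dvd_iff.1 this j (Nat.lt_succ_self j)
  have h2 : subst φ (trunc (j + 1) f : ℂ⟦X⟧) =
      ∑ k ∈ Finset.range (j + 1), C (coeff k f) * φ ^ k := by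
    rw [subst_coe hs, Polynomial.aeval_eq_sum_range' (natDegree_trunc_lt f j)]
    refine Finset.sum_congr rfl fun k hk => ?_
    rw [coeff_trunc, if_pos (Finset.mem_range.1 hk), smul_eq_C_mul]
  conv_lhs => rw [hh]
  rw [subst_add hs, mul_add, map_add, h1, zero_add, h2, Finset.mul_sum, map_sum]
  refine Finset.sum_congr rfl fun k _ => ?_
  rw [mul_left_comm, coeff_C_mul, mul_comm]

lemma coeff_mul_pow_self {φ : ℂ⟦X⟧} (hφ : constantCoeff φ = 0) (g : ℂ⟦X⟧) (j : ℕ) :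
    coeff j (g * φ ^ j) = coeff 0 g * coeff 1 φ ^ j := by
  obtain ⟨ψ, rfl⟩ := X_dvd_iff.2 hφ
  rw [coeff_mul_X_mul_pow, if_pos le_rfl,
    show coeff 1 (X * ψ) = coeff 0 ψ from coeff_succ_X_mul 0 ψ]
  simp

lemma subst_rationalArc {φ : ℂ⟦X⟧} (hφ : constantCoeff φ = 0) (g : ℂ⟦X⟧)
    (A : Matrix (Fin (n + 1)) (Fin (n + 1)) ℂ) (g' φ' : ℂ⟦X⟧) (i : Fin (n + 1)) :
    g * subst φ (rationalArc A g' φ' i) =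
      rationalArc A (g * subst φ g') (subst φ φ') i := by
  have hs : HasSubst φ := HasSubst.of_constantCoeff_zero' hφ
  have hC : ∀ c : ℂ, subst φ (C c : ℂ⟦X⟧) = C c := fun c => subst_C c
  simp only [rationalArc, ← coe_substAlgHom hs, map_sum, map_mul, map_pow, Finset.mul_sum]
  refine Finset.sum_congr rfl fun k _ => ?_
  rw [coe_substAlgHom hs, hC]
  ring

/-- The linear form of a triangular change of a sequence of vectors. -/
lemma exists_lastMinor_eq_mul {v w : ℕ → Fin (n + 1) → ℂ} {M : ℕ → ℕ → ℂ}
    (hw : ∀ j, w j = ∑ k ∈ Finset.range (j + 1), M j k • v k) (hM : ∀ j, M j j ≠ 0) :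
    ∃ μ : ℂ, μ ≠ 0 ∧ ∀ x, lastMinor w x = μ * lastMinor v x := by
  set T : Matrix (Fin (n + 1)) (Fin (n + 1)) ℂ := Matrix.of fun k j =>
    if (j : ℕ) = n then (if k = j then 1 else 0) else if (k : ℕ) ≤ j then M j k else 0 with hT
  refine ⟨T.det, ?_, fun x => ?_⟩
  · rw [Matrix.det_of_isUpperTriangular]
    · refine Finset.prod_ne_zero_iff.2 fun i _ => ?_
      by_cases h : (i : ℕ) = n <;> simp [hT, h, hM]
    · intro k j hkj
      have h1 : (j : ℕ) < k := hkj
      simp only [hT, Matrix.of_apply]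
      rw [if_neg (by omega), if_neg (by omega)]
  · rw [lastMinor_apply, lastMinor_apply, mul_comm, ← Matrix.det_mul]
    congr 1
    ext i j
    simp only [Matrix.mul_apply, Matrix.of_apply, hT]
    by_cases h : (j : ℕ) = n
    · simp [h]
    · have hj := j.2
      simp only [h, if_false, mul_ite, mul_zero]
      rw [Fin.sum_univ_eq_sum_range (fun k => if k ≤ (j : ℕ) then
        (if k = n then x i else v k i) * M j k else 0) (n + 1), ← Finset.sum_filter, hw]
      rw [Finset.sum_apply]
      refine Finset.sum_congr ?_ fun k hk => ?_
      · ext k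
        simp only [Finset.mem_range, Finset.mem_filter]
        omega
      · have := (Finset.mem_filter.1 hk).2
        rw [if_neg (by omega), Pi.smul_apply, smul_eq_mul, mul_comm]

lemma lastMinor_sum_range (v : ℕ → Fin (n + 1) → ℂ) (c : ℕ → ℂ) :
    lastMinor v (∑ k ∈ Finset.range (n + 1), c k • v k) = c n * lastMinor v (v n) := by
  rw [Finset.sum_range_succ, map_add, map_sum, Finset.sum_eq_zero, zero_add, map_smul, smul_eq_mul]
  intro k hk
  rw [map_smul, lastMinor_apply_of_lt v (Finset.mem_range.1 hk), smul_zero]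

lemma mongeForm_of_pluecker_nil_eq_zero {v : ℕ → Fin (n + 1) → ℂ} (h : pluecker v [] = 0) :
    mongeForm v = 2 * pluecker v [1] ^ 3 := by
  simp [mongeForm, h]

/-- No transformation law of the polynomial is computed. If `U ≠ 0`, the value is `U² det(a₀, …,
aₙ₋₁, d)`, where `d` is the deviation from a rational arc in degree `n + 3`, and each factor is
rescaled by a non-zero number. If `U = 0`, the value is `2 U₁³`, and `U₁` is rescaled. -/
theorem mongeForm_eq_zero_iff_of_sameArc (hn : 2 ≤ n) {a b : ParamArc n} (hab : SameArc a b) :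
    mongeForm a.vec = 0 ↔ mongeForm b.vec = 0 := by
  obtain ⟨g, φ, hg, hφ, hφ1, h⟩ := hab
  rw [coeff_zero_eq_constantCoeff] at hφ
  set M : ℕ → ℕ → ℂ := fun j k => coeff j (g * φ ^ k) with hM
  have hM0 : ∀ j, M j j ≠ 0 := fun j => by
    rw [hM]
    simp only [coeff_mul_pow_self hφ]
    exact mul_ne_zero hg (pow_ne_zero _ hφ1)
  have htr : ∀ (x : Fin (n + 1) → ℂ⟦X⟧) (j : ℕ), taylor (fun i => g * subst φ (x i)) j =
      ∑ k ∈ Finset.range (j + 1), M j k • taylor x k := fun x j => by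
    ext i
    simp [taylor, coeff_mul_subst hφ, hM]
  have hb : ∀ j, b.vec j = ∑ k ∈ Finset.range (j + 1), M j k • a.vec k := fun j => by
    rw [← show taylor a.series = a.vec from rfl, ← htr, ← show taylor b.series = b.vec from rfl]
    congr 1
    ext1 i
    exact h i
  by_cases hU : pluecker a.vec [] = 0
  · obtain ⟨μ, hμ, hD⟩ := exists_lastMinor_eq_mul hb hM0
    have hU' := hU
    rw [pluecker_nil] at hU'
    have hUb : pluecker b.vec [] = 0 := by
      rw [pluecker_nil, hD, hb, lastMinor_sum_range, hU', mul_zero, mul_zero]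
    have hUb1 : pluecker b.vec [1] = μ * (M (n + 1) (n + 1) * pluecker a.vec [1]) := by
      rw [pluecker_singleton, pluecker_singleton, hD, hb, Finset.sum_range_succ, map_add,
        lastMinor_sum_range, hU', map_smul, mul_zero, zero_add, smul_eq_mul]
    rw [mongeForm_of_pluecker_nil_eq_zero hU, mongeForm_of_pluecker_nil_eq_zero hUb, hUb1]
    simp [hμ, hM0]
  · obtain ⟨A, g', ψ, -, -, -, hA⟩ := exists_rationalArc hU
    set γ := rationalArc A g' (X * ψ)
    have hγ' := subst_rationalArc (n := n) hφ g A g' (X * ψ)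
    set γ' := rationalArc (n := n) A (g * subst φ g') (subst φ (X * ψ))
    have hγγ' : ∀ j, taylor γ' j = ∑ k ∈ Finset.range (j + 1), M j k • taylor γ k := fun j => by
      rw [← htr]
      congr 1
      ext1 i
      exact (hγ' i).symm
    obtain ⟨μ, hμ, hD⟩ := exists_lastMinor_eq_mul hγγ' hM0
    have hb' : ∀ j < n + 3, b.vec j = taylor γ' j := fun j hj => by
      rw [hb, hγγ']
      refine Finset.sum_congr rfl fun k hk => ?_
      have := Finset.mem_range.1 hk
      rw [hA k (by omega)]
    have hUγ : pluecker (taylor γ) [] ≠ 0 := by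
      rwa [pluecker_nil, ← lastMinor_congr fun j hj => hA j (by omega), ← hA n (by omega),
        ← pluecker_nil]
    have hUγ' : pluecker (taylor γ') [] ≠ 0 := by
      rw [pluecker_nil] at hUγ
      rw [pluecker_nil, hD, hγγ', lastMinor_sum_range]
      exact mul_ne_zero hμ (mul_ne_zero (hM0 n) hUγ)
    have hd : b.vec (n + 3) - taylor γ' (n + 3) =
        M (n + 3) (n + 3) • (a.vec (n + 3) - taylor γ (n + 3)) := by
      -- The two arcs agree below degree `n + 3`, so only the diagonal term survives in the
      -- difference.
      rw [hb, hγγ', Finset.sum_range_succ, Finset.sum_range_succ _ (n + 3), smul_sub,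
        Finset.sum_congr rfl fun k hk => by rw [hA k (Finset.mem_range.1 hk)]]
      abel
    rw [mongeForm_eq_add hA, mongeForm_eq_add hb', mongeForm_rationalArc hn,
      mongeForm_rationalArc hn, hd, hD, map_smul]
    simp [hUγ, hUγ', hμ, hM0]

end Invariance

/-! ### Osculating hyperplanes, rational curves and the quadrics through them. -/

section Geometry

open PowerSeries

variable {n : ℕ}

lemma ParamArc.nonInflexional_iff (a : ParamArc n) :
    a.NonInflexional ↔ pluecker a.vec [] ≠ 0 := by
  rw [pluecker_nil', ← isUnit_iff_ne_zero, ← Matrix.isUnit_iff_isUnit_det,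
    ← Matrix.linearIndependent_cols_iff_isUnit]
  rfl

lemma ParamArc.lastMinor_eq_zero_of_mem (a : ParamArc n) {x : Fin (n + 1) → ℂ}
    (hx : x ∈ a.osculatingHyperplane) : lastMinor a.vec x = 0 := by
  have : a.osculatingHyperplane ≤ LinearMap.ker (lastMinor a.vec) := by
    refine Submodule.span_le.2 ?_
    rintro _ ⟨j, hj, rfl⟩
    exact lastMinor_apply_of_lt a.vec hj
  exact this hx

lemma ParamArc.mem_osculatingHyperplane (a : ParamArc n) (ha : pluecker a.vec [] ≠ 0)
    {x : Fin (n + 1) → ℂ} (hx : lastMinor a.vec x = 0) : x ∈ a.osculatingHyperplane := by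
  have hdet := ha
  rw [pluecker_nil'] at hdet
  set M : Matrix (Fin (n + 1)) (Fin (n + 1)) ℂ := Matrix.of fun i j => a.vec j i with hM
  set c := M⁻¹.mulVec x
  have hc : x = ∑ j : Fin (n + 1), c j • a.vec j := by
    have : M.mulVec c = x := by
      rw [Matrix.mulVec_mulVec, Matrix.mul_nonsing_inv _ hdet.isUnit, Matrix.one_mulVec]
    rw [← this]
    ext i
    simp [Matrix.mulVec, dotProduct, hM, mul_comm]
  rw [Fin.sum_univ_castSucc] at hc
  have h0 : c (Fin.last n) = 0 := by
    have h1 := hx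
    rw [hc, map_add, map_sum, Finset.sum_eq_zero, zero_add, map_smul, Fin.val_last,
      ← pluecker_nil, smul_eq_mul] at h1
    · exact (mul_eq_zero.1 h1).resolve_right ha
    · intro j _
      rw [map_smul, Fin.val_castSucc, lastMinor_apply_of_lt a.vec j.2, smul_zero]
  rw [hc, h0, zero_smul, add_zero]
  exact Submodule.sum_mem _ fun j _ =>
    Submodule.smul_mem _ _ (Submodule.subset_span ⟨j, j.2, rfl⟩)

/-- First order expansion of a polynomial along power series. -/
lemma exists_aeval_eq_add {ι : Type*} [Fintype ι] [DecidableEq ι] {x y z : ι → ℂ⟦X⟧} {r : ℕ}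
    (hr : r ≠ 0) (h : ∀ i, x i = y i + X ^ r * z i) (F : MvPolynomial ι ℂ) :
    ∃ e : ℂ⟦X⟧, MvPolynomial.aeval x F = MvPolynomial.aeval y F + X ^ r * e ∧
      constantCoeff e = ∑ i, MvPolynomial.eval (fun i => constantCoeff (y i))
        (MvPolynomial.pderiv i F) * constantCoeff (z i) := by
  have hev : ∀ p : MvPolynomial ι ℂ, constantCoeff (MvPolynomial.aeval y p) =
      MvPolynomial.eval (fun i => constantCoeff (y i)) p := fun p => by
    induction p using MvPolynomial.induction_on with
    | C c => simp
    | add p q hp hq => simp [hp, hq]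
    | mul_X p k hp => simp [hp]
  induction F using MvPolynomial.induction_on with
  | C c => exact ⟨0, by simp, by simp⟩
  | add p q hp hq =>
    obtain ⟨e, he, he'⟩ := hp
    obtain ⟨f, hf, hf'⟩ := hq
    refine ⟨e + f, ?_, ?_⟩
    · rw [map_add, map_add, he, hf]; ring
    · simp only [map_add, he', hf', add_mul, Finset.sum_add_distrib]
  | mul_X p k hp =>
    obtain ⟨e, he, he'⟩ := hp
    refine ⟨e * y k + MvPolynomial.aeval y p * z k + X ^ r * (e * z k), ?_, ?_⟩
    · rw [map_mul, map_mul, he, MvPolynomial.aeval_X, MvPolynomial.aeval_X, h]; ring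
    · simp only [map_add, map_mul, he', hev, map_pow, constantCoeff_X, zero_pow hr, zero_mul,
        add_zero, Derivation.leibniz, MvPolynomial.pderiv_X, smul_eq_mul, MvPolynomial.eval_X,
        add_mul, Finset.sum_add_distrib, Finset.sum_mul]
      rw [add_comm]
      congr 1
      · rw [Finset.sum_eq_single k (fun b _ hb => by simp [hb]) (by simp)]
        simp
      · exact Finset.sum_congr rfl fun i _ => by ring

/-- The affine cone over a rational curve. -/
def curveCone (A : Matrix (Fin (n + 1)) (Fin (n + 1)) ℂ) : Set (Fin (n + 1) → ℂ) :=
  {x | ∃ s t : ℂ, x = A.mulVec fun i => s ^ (n - (i : ℕ)) * t ^ (i : ℕ)}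

lemma isNormalRationalCurve_iff {Γ : Set (Fin (n + 1) → ℂ)} :
    IsNormalRationalCurve Γ ↔
      ∃ A : Matrix (Fin (n + 1)) (Fin (n + 1)) ℂ, A.det ≠ 0 ∧ Γ = curveCone A := by
  constructor
  · rintro ⟨A, rfl⟩
    exact ⟨A, (Matrix.isUnit_iff_isUnit_det _).1 A.isUnit |>.ne_zero, rfl⟩
  · rintro ⟨A, hA, rfl⟩
    exact ⟨Matrix.GeneralLinearGroup.mkOfDetNeZero A hA, rfl⟩

/-- Interchanging `s` and `t` lets the point with parameter `∞` be treated like a finite one. -/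
lemma curveCone_submatrix_rev (A : Matrix (Fin (n + 1)) (Fin (n + 1)) ℂ) :
    curveCone (A.submatrix id Fin.rev) = curveCone A := by
  have key : ∀ s t : ℂ,
      ((A.submatrix id Fin.rev).mulVec fun i => s ^ (n - (i : ℕ)) * t ^ (i : ℕ)) =
      A.mulVec fun i => t ^ (n - (i : ℕ)) * s ^ (i : ℕ) := fun s t => by
    ext i
    simp only [Matrix.mulVec, dotProduct, Matrix.submatrix_apply, id]
    rw [← Equiv.sum_comp Fin.revPerm]
    refine Finset.sum_congr rfl fun k _ => ?_
    have hk := k.2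
    rw [Fin.revPerm_apply, Fin.rev_rev, Fin.val_rev, show n - (n + 1 - ((k : ℕ) + 1)) = k by omega,
      show n + 1 - ((k : ℕ) + 1) = n - k by omega, mul_comm (s ^ _)]
  ext x
  constructor
  · rintro ⟨s, t, rfl⟩
    exact ⟨t, s, key s t⟩
  · rintro ⟨s, t, rfl⟩
    exact ⟨t, s, (key t s).symm⟩

lemma aeval_rationalArc (hn : n ≠ 0) {A : Matrix (Fin (n + 1)) (Fin (n + 1)) ℂ}
    {F : MvPolynomial (Fin (n + 1)) ℂ} (hF : F ∈ MvPolynomial.vanishingIdeal ℂ (curveCone A))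
    (g φ : ℂ⟦X⟧) : MvPolynomial.aeval (rationalArc A g φ) F = 0 := by
  set P : Fin (n + 1) → MvPolynomial (Fin 2) ℂ := fun i =>
    ∑ k : Fin (n + 1), MvPolynomial.C (A i k) *
      (MvPolynomial.X 0 * MvPolynomial.X 1 ^ (k : ℕ)) with hP
  have h0 : MvPolynomial.aeval P F = 0 := by
    refine MvPolynomial.funext fun x => ?_
    -- An `n`-th root `s` of `x 0` puts `x 0 · (1, x 1, …, (x 1)ⁿ)` on the cone. Thus `F` vanishes
    -- identically on the two-parameter family `P`, into which `g` and `φ` are then substituted.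
    obtain ⟨s, hs⟩ := IsAlgClosed.exists_pow_nat_eq (x 0) (Nat.pos_of_ne_zero hn)
    have hx : A.mulVec (fun i => s ^ (n - (i : ℕ)) * (s * x 1) ^ (i : ℕ)) =
        fun i => MvPolynomial.eval x (P i) := by
      ext i
      simp only [Matrix.mulVec, dotProduct, hP, map_sum, map_mul, map_pow, MvPolynomial.eval_C,
        MvPolynomial.eval_X]
      refine Finset.sum_congr rfl fun k _ => ?_
      rw [← hs, mul_pow, ← mul_assoc (s ^ _), ← pow_add, Nat.sub_add_cancel (by omega)]
    have h1 := hF _ ⟨s, s * x 1, rfl⟩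
    rw [hx] at h1
    rw [map_zero, ← h1, ← MvPolynomial.coe_aeval_eq_eval, RingHom.coe_coe,
      ← MvPolynomial.comp_aeval_apply]
  have h1 : rationalArc A g φ = fun i => MvPolynomial.aeval ![g, φ] (P i) := by
    ext1 i
    simp [rationalArc, hP]
  rw [h1, ← MvPolynomial.comp_aeval_apply, h0, map_zero]

/-- The linear form with coefficients `c`. -/
def linearForm (c : Fin (n + 1) → ℂ) : MvPolynomial (Fin (n + 1)) ℂ :=
  ∑ l, MvPolynomial.C (c l) * MvPolynomial.X l

lemma aeval_linearForm (c : Fin (n + 1) → ℂ) (x : Fin (n + 1) → ℂ⟦X⟧) :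
    MvPolynomial.aeval x (linearForm c) = ∑ l, C (c l) * x l := by
  simp [linearForm]

lemma eval_linearForm (c x : Fin (n + 1) → ℂ) :
    MvPolynomial.eval x (linearForm c) = c ⬝ᵥ x := by
  simp [linearForm, dotProduct]

lemma linearForm_isHomogeneous (c : Fin (n + 1) → ℂ) : (linearForm c).IsHomogeneous 1 := by
  refine MvPolynomial.IsHomogeneous.sum _ _ _ fun l _ => ?_
  simpa using (MvPolynomial.isHomogeneous_C _ (c l)).mul (MvPolynomial.isHomogeneous_X ℂ l)

/-- The quadric `xᵢ xⱼ₊₁ - xᵢ₊₁ xⱼ` in the coordinates given by the rows of `B`. -/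
def quadric (B : Matrix (Fin (n + 1)) (Fin (n + 1)) ℂ) (i j : ℕ) :
    MvPolynomial (Fin (n + 1)) ℂ :=
  linearForm (B (Fin.ofNat (n + 1) i)) * linearForm (B (Fin.ofNat (n + 1) (j + 1))) -
    linearForm (B (Fin.ofNat (n + 1) (i + 1))) * linearForm (B (Fin.ofNat (n + 1) j))

lemma quadric_isHomogeneous (B : Matrix (Fin (n + 1)) (Fin (n + 1)) ℂ) (i j : ℕ) :
    (quadric B i j).IsHomogeneous 2 :=
  ((linearForm_isHomogeneous _).mul (linearForm_isHomogeneous _)).sub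
    ((linearForm_isHomogeneous _).mul (linearForm_isHomogeneous _))

lemma quadric_mem_vanishingIdeal {A B : Matrix (Fin (n + 1)) (Fin (n + 1)) ℂ} (h : B * A = 1)
    {i j : ℕ} (hi : i < n) (hj : j < n) :
    quadric B i j ∈ MvPolynomial.vanishingIdeal ℂ (curveCone A) := by
  rintro _ ⟨s, t, rfl⟩
  have key : ∀ k ≤ n, B (Fin.ofNat (n + 1) k) ⬝ᵥ
      (A.mulVec fun i => s ^ (n - (i : ℕ)) * t ^ (i : ℕ)) = s ^ (n - k) * t ^ k := fun k hk => by
    change B.mulVec (A.mulVec _) (Fin.ofNat (n + 1) k) = _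
    rw [Matrix.mulVec_mulVec, h, Matrix.one_mulVec, Fin.val_ofNat,
      Nat.mod_eq_of_lt (Nat.lt_succ_of_le hk)]
  rw [MvPolynomial.aeval_eq_eval, quadric, map_sub, map_mul, map_mul]
  simp only [eval_linearForm]
  rw [key i hi.le, key (j + 1) hj, key (i + 1) hi, key j hj.le,
    show n - i = n - (i + 1) + 1 by omega, show n - j = n - (j + 1) + 1 by omega]
  ring

lemma eval_pderiv_quadric (B : Matrix (Fin (n + 1)) (Fin (n + 1)) ℂ) (i j : ℕ)
    (x v : Fin (n + 1) → ℂ) :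
    ∑ k, MvPolynomial.eval x (MvPolynomial.pderiv k (quadric B i j)) * v k =
      B.mulVec x (Fin.ofNat (n + 1) i) * B.mulVec v (Fin.ofNat (n + 1) (j + 1)) +
      B.mulVec x (Fin.ofNat (n + 1) (j + 1)) * B.mulVec v (Fin.ofNat (n + 1) i) -
      B.mulVec x (Fin.ofNat (n + 1) (i + 1)) * B.mulVec v (Fin.ofNat (n + 1) j) -
      B.mulVec x (Fin.ofNat (n + 1) j) * B.mulVec v (Fin.ofNat (n + 1) (i + 1)) := by
  have h : ∀ (c : Fin (n + 1) → ℂ) k, MvPolynomial.eval x (MvPolynomial.pderiv k (linearForm c)) =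
      c k := fun c k => by
    simp [linearForm, Derivation.leibniz, MvPolynomial.pderiv_X, Pi.single_apply]
  simp only [quadric, map_sub, map_add, Derivation.leibniz, smul_eq_mul, map_mul, h,
    eval_linearForm]
  simp only [Matrix.mulVec, sub_mul, add_mul, Finset.sum_sub_distrib, Finset.sum_add_distrib,
    mul_assoc, ← Finset.mul_sum]
  simp only [dotProduct]
  ring

end Geometry

/-! ### The principal plane and the osculating hyperplane. -/

section PrincipalPlane

open PowerSeries

variable {n : ℕ}

/-- Take `φ = y₁ / y₀`: modulo `tʳ` the hypothesis is a geometric recursion with ratio `φ`. -/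
lemma exists_dvd_sub_mul_pow {y : ℕ → ℂ⟦X⟧} {m r : ℕ} (h0 : constantCoeff (y 0) ≠ 0)
    (h : ∀ j < m, X ^ r ∣ y 0 * y (j + 1) - y 1 * y j) :
    ∃ φ : ℂ⟦X⟧, ∀ j ≤ m, X ^ r ∣ y j - y 0 * φ ^ j := by
  have hinv : y 0 * (y 0)⁻¹ = 1 := PowerSeries.mul_inv_cancel _ h0
  refine ⟨y 1 * (y 0)⁻¹, fun j hj => ?_⟩
  induction j with
  | zero => simp
  | succ j ih =>
    have : y (j + 1) - y 0 * (y 1 * (y 0)⁻¹) ^ (j + 1) =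
        (y 0)⁻¹ * (y 0 * y (j + 1) - y 1 * y j) +
          y 1 * (y 0)⁻¹ * (y j - y 0 * (y 1 * (y 0)⁻¹) ^ j) := by
      rw [pow_succ]
      linear_combination (-y (j + 1)) * hinv
    rw [this]
    exact dvd_add (dvd_mul_of_dvd_right (h j hj) _)
      (dvd_mul_of_dvd_right (ih (by omega)) _)

lemma ParamArc.constantCoeff_ne_zero (a : ParamArc n) :
    ∃ i, constantCoeff (a.series i) ≠ 0 := by
  by_contra! h
  refine a.smooth.ne_zero 0 ?_
  ext i
  simpa using h i

/-- A thick point of length `r` of a normal rational curve comes from a parametrisation of the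
curve. -/
theorem exists_rationalArc_of_thickPointSubset (hn : 2 ≤ n) (a : ParamArc n) {r : ℕ} (hr : r ≠ 0)
    {Γ : Set (Fin (n + 1) → ℂ)} (hΓ : IsNormalRationalCurve Γ) (h : a.ThickPointSubset r Γ) :
    ∃ (A : Matrix (Fin (n + 1)) (Fin (n + 1)) ℂ) (g φ : ℂ⟦X⟧), Γ = curveCone A ∧
      ∀ i, X ^ r ∣ a.series i - rationalArc A g φ i := by
  obtain ⟨A, hA, rfl⟩ := isNormalRationalCurve_iff.1 hΓ
  have hBA : A⁻¹ * A = 1 := Matrix.nonsing_inv_mul _ hA.isUnit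
  have hAB : A * A⁻¹ = 1 := Matrix.mul_nonsing_inv _ hA.isUnit
  set y : ℕ → ℂ⟦X⟧ := fun k => ∑ l, C (A⁻¹ (Fin.ofNat (n + 1) k) l) * a.series l with hy
  have hq : ∀ i j, i < n → j < n → X ^ r ∣ y i * y (j + 1) - y (i + 1) * y j := by
    intro i j hi hj
    have := h 2 _ (quadric_isHomogeneous A⁻¹ i j) (quadric_mem_vanishingIdeal hBA hi hj)
    simpa only [ParamArc.VanishesToOrder, quadric, map_sub, map_mul, aeval_linearForm] using this
  have ha : ∀ i, a.series i = ∑ k : Fin (n + 1), C (A i k) * y k := by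
    intro i
    have h1 : ∀ l, ∑ k, C (A i k) * C (A⁻¹ k l) =
        C ((1 : Matrix (Fin (n + 1)) (Fin (n + 1)) ℂ) i l) :=
      fun l => by rw [← hAB, Matrix.mul_apply, map_sum]; simp only [map_mul]
    simp only [hy, Finset.mul_sum, ← mul_assoc, Fin.ofNat_eq_cast, Fin.cast_val_eq_self]
    rw [Finset.sum_comm]
    simp only [← Finset.sum_mul, h1]
    simp [Matrix.one_apply]
  -- If `y₀` vanishes at `O`, the quadrics force `y₁, …, yₙ₋₁` to vanish there too, so `O` has
  -- parameter `∞` and the coordinates are read backwards.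
  by_cases h0 : constantCoeff (y 0) = 0
  · have hqc : ∀ i j, i < n → j < n → constantCoeff (y i) * constantCoeff (y (j + 1)) =
        constantCoeff (y (i + 1)) * constantCoeff (y j) := fun i j hi hj => by
      have := X_dvd_iff.1 ((dvd_pow_self X hr).trans (hq i j hi hj))
      rwa [map_sub, map_mul, map_mul, sub_eq_zero] at this
    have hlt : ∀ j < n, constantCoeff (y j) = 0 := fun j => by
      induction j with
      | zero => exact fun _ => h0
      | succ j ih =>
        intro hj
        have := hqc j (j + 1) (by omega) hj
        rw [ih (by omega), zero_mul] at this
        simpa using this.symm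
    have hyn : constantCoeff (y n) ≠ 0 := fun hyn => by
      obtain ⟨i, hi⟩ := a.constantCoeff_ne_zero
      refine hi ?_
      rw [ha, map_sum]
      refine Finset.sum_eq_zero fun k _ => ?_
      rw [map_mul]
      rcases lt_or_eq_of_le (Nat.lt_succ_iff.1 k.2) with hk | hk
      · rw [hlt k hk, mul_zero]
      · rw [hk, hyn, mul_zero]
    obtain ⟨φ, hφ⟩ := exists_dvd_sub_mul_pow (y := fun j => y (n - j)) (m := n) (r := r) hyn
      (fun j hj => by
        have := hq (n - 1) (n - (j + 1)) (by omega) (by omega)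
        rw [show n - (j + 1) + 1 = n - j by omega, show n - 1 + 1 = n by omega, ← dvd_neg] at this
        simpa using this)
    refine ⟨A.submatrix id Fin.rev, y n, φ, (curveCone_submatrix_rev A).symm, fun i => ?_⟩
    rw [ha, rationalArc, ← Equiv.sum_comp Fin.revPerm, ← Finset.sum_sub_distrib]
    refine Finset.dvd_sum fun k _ => ?_
    have := hφ k (Nat.lt_succ_iff.1 k.2)
    rw [Matrix.submatrix_apply, id, Fin.revPerm_apply, ← mul_sub, Fin.val_rev,
      show n + 1 - ((k : ℕ) + 1) = n - k by omega]
    exact dvd_mul_of_dvd_right this _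
  · obtain ⟨φ, hφ⟩ := exists_dvd_sub_mul_pow (m := n) (r := r) h0
      (fun j hj => hq 0 j (by omega) hj)
    refine ⟨A, y 0, φ, rfl, fun i => ?_⟩
    rw [ha, rationalArc, ← Finset.sum_sub_distrib]
    refine Finset.dvd_sum fun k _ => ?_
    rw [← mul_sub]
    exact dvd_mul_of_dvd_right (hφ k (Nat.lt_succ_iff.1 k.2)) _

lemma constantCoeff_rationalArc_eq {r : ℕ} (hr : r ≠ 0) {x y z : Fin (n + 1) → ℂ⟦X⟧}
    (h : ∀ i, x i = y i + X ^ r * z i) (i : Fin (n + 1)) :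
    constantCoeff (y i) = constantCoeff (x i) := by
  simp [h, hr]

lemma taylor_sub_eq {r : ℕ} {x y z : Fin (n + 1) → ℂ⟦X⟧} (h : ∀ i, x i = y i + X ^ r * z i) :
    (∀ j < r, taylor x j = taylor y j) ∧
      taylor x r - taylor y r = fun i => constantCoeff (z i) := by
  refine ⟨fun j hj => ?_, ?_⟩
  · ext i
    simp [taylor, h, coeff_X_pow_mul', hj.not_ge]
  · ext i
    simp [taylor, h, coeff_X_pow_mul']

/-- The Monge polynomial vanishes when the principal plane lies in the osculating hyperplane. -/
theorem mongeForm_eq_zero_of_principalPlane_le (hn : 2 ≤ n) (a : ParamArc n)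
    {Γ : Set (Fin (n + 1) → ℂ)} (hΓ : IsNormalRationalCurve Γ) (h : a.ThickPointSubset (n + 3) Γ)
    (hle : a.principalPlane Γ ≤ a.osculatingHyperplane) : mongeForm a.vec = 0 := by
  obtain ⟨A, g, φ, rfl, hA⟩ := exists_rationalArc_of_thickPointSubset hn a (by omega) hΓ h
  choose z hz using hA
  have hz' : ∀ i, a.series i = rationalArc A g φ i + X ^ (n + 3) * z i := fun i => by
    rw [← hz]; ring
  obtain ⟨h1, h2⟩ := taylor_sub_eq hz'
  -- A form `F` that vanishes on `Γ` takes the value `tⁿ⁺³ (dF(d) + O(t))` at `a`, with `dF` taken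
  -- at `a₀`; vanishing to order `n + 4` means `dF(d) = 0`.
  have hd : (fun i => constantCoeff (z i)) ∈ a.principalPlane (curveCone A) := by
    intro m F _ hF hFa
    obtain ⟨e, he, he'⟩ := exists_aeval_eq_add (by omega) hz' F
    rw [aeval_rationalArc (by omega) hF, zero_add] at he
    rw [ParamArc.VanishesToOrder, he, pow_succ, mul_dvd_mul_iff_left (pow_ne_zero _ X_ne_zero),
      X_dvd_iff, he'] at hFa
    simp only [constantCoeff_rationalArc_eq (by omega) hz'] at hFa
    have h4 : (fun i => constantCoeff (a.series i)) = a.vec 0 := by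
      ext i; simp [ParamArc.vec]
    rwa [h4] at hFa
  have hD := a.lastMinor_eq_zero_of_mem (hle hd)
  rw [← h2] at hD
  change mongeForm (taylor a.series) = 0
  rw [mongeForm_eq_add h1, mongeForm_rationalArc hn, ← lastMinor_congr fun j hj => h1 j (by omega)]
  change _ + _ * lastMinor a.vec _ = 0
  rw [hD, mul_zero, add_zero]

lemma lastMinor_of_triangular {v : ℕ → Fin (n + 1) → ℂ}
    (h : ∀ (j : ℕ) (i : Fin (n + 1)), j < i → v j i = 0) :
    ∃ c : ℂ, ∀ x, lastMinor v x = c * x (Fin.last n) := by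
  refine ⟨∏ j : Fin n, v j j.castSucc, fun x => ?_⟩
  rw [lastMinor_apply, Matrix.det_of_isUpperTriangular]
  · rw [Fin.prod_univ_castSucc]
    simp [fun j : Fin n => j.2.ne]
  · intro i j hij
    have h1 : (j : ℕ) < i := hij
    have := i.2
    rw [Matrix.of_apply, if_neg (by omega), h _ _ h1]

/-- If the Monge polynomial vanishes at a non-inflexional arc, its principal plane lies in the
osculating hyperplane. -/
theorem exists_principalPlane_le (hn : 2 ≤ n) (a : ParamArc n) (hU : pluecker a.vec [] ≠ 0)
    (hF : mongeForm a.vec = 0) :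
    ∃ Γ : Set (Fin (n + 1) → ℂ), IsNormalRationalCurve Γ ∧ a.ThickPointSubset (n + 3) Γ ∧
      a.principalPlane Γ ≤ a.osculatingHyperplane := by
  obtain ⟨A, g, ψ, hA, hg, -, h1⟩ := exists_rationalArc hU
  have hBA : A⁻¹ * A = 1 := Matrix.nonsing_inv_mul _ hA.isUnit
  have hAB : A * A⁻¹ = 1 := Matrix.mul_nonsing_inv _ hA.isUnit
  have hdvd : ∀ i, X ^ (n + 3) ∣ a.series i - rationalArc A g (X * ψ) i := fun i => by
    refine X_pow_dvd_iff.2 fun j hj => ?_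
    rw [map_sub, sub_eq_zero]
    exact congrFun (h1 j hj) i
  choose z hz using hdvd
  have hz' : ∀ i, a.series i = rationalArc A g (X * ψ) i + X ^ (n + 3) * z i := fun i => by
    rw [← hz]; ring
  obtain ⟨-, h2⟩ := taylor_sub_eq hz'
  set d : Fin (n + 1) → ℂ := fun i => constantCoeff (z i)
  set c := standardTaylor n g (X * ψ) with hc
  have htri : ∀ (j : ℕ) (i : Fin (n + 1)), j < i → c j i = 0 := fun j i hij => by
    rw [hc, standardTaylor, coeff_mul_X_mul_pow, if_neg (by omega)]
  have hlast : ∀ x, lastMinor a.vec x = A.det * lastMinor c (A⁻¹.mulVec x) := fun x => by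
    rw [← lastMinor_mulVec, Matrix.mulVec_mulVec, hAB, Matrix.one_mulVec, hc,
      ← taylor_rationalArc, lastMinor_congr fun j hj => h1 j (by omega)]
  obtain ⟨μ, hμ⟩ : ∃ μ : ℂ, ∀ x, lastMinor a.vec x = μ * A⁻¹.mulVec x (Fin.last n) := by
    obtain ⟨μ, hμ⟩ := lastMinor_of_triangular htri
    exact ⟨A.det * μ, fun x => by rw [hlast, hμ, mul_assoc]⟩
  have hd : A⁻¹.mulVec d (Fin.last n) = 0 := by
    have hU' := hU
    rw [pluecker_nil, hμ] at hU'
    have h3 : pluecker (taylor (rationalArc A g (X * ψ))) [] ≠ 0 := by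
      rwa [pluecker_nil, ← lastMinor_congr fun j hj => h1 j (by omega), ← h1 n (by omega),
        ← pluecker_nil]
    rw [mongeForm_eq_add h1, mongeForm_rationalArc hn,
      ← lastMinor_congr fun j hj => h1 j (by omega), zero_add] at hF
    have h4 := (mul_eq_zero.1 hF).resolve_left (pow_ne_zero _ h3)
    change lastMinor a.vec (taylor a.series (n + 3) - _) = 0 at h4
    rw [h2, hμ] at h4
    exact (mul_eq_zero.1 h4).resolve_left (left_ne_zero_of_mul hU')
  have ha0 : A⁻¹.mulVec (a.vec 0) = fun i => if i = 0 then coeff 0 g else 0 := by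
    rw [h1 0 (by omega), taylor_rationalArc]
    simp only [Matrix.mulVec_mulVec, hBA, Matrix.one_mulVec]
    ext i
    by_cases hi : i = 0
    · simp [hi, standardTaylor]
    · rw [if_neg hi]
      exact htri 0 i (Nat.pos_of_ne_zero fun h => hi (Fin.ext h))
  -- In the coordinates of the curve, the quadric `x₀ xₙ - x₁ xₙ₋₁` is tangent at `O` to the
  -- osculating hyperplane `xₙ = 0`.
  have hlam : ∀ v, ∑ k, MvPolynomial.eval (a.vec 0) (MvPolynomial.pderiv k
      (quadric A⁻¹ 0 (n - 1))) * v k = coeff 0 g * A⁻¹.mulVec v (Fin.last n) := fun v => by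
    have e1 : Fin.ofNat (n + 1) (n - 1 + 1) = Fin.last n := by
      ext; simp [Nat.sub_add_cancel (show 1 ≤ n by omega)]
    have e2 : Fin.ofNat (n + 1) (n - 1) ≠ 0 := by
      rw [Ne, Fin.ext_iff, Fin.val_ofNat, Nat.mod_eq_of_lt (by omega)]; simp; omega
    have e3 : Fin.ofNat (n + 1) (0 + 1) ≠ 0 := by
      rw [Ne, Fin.ext_iff, Fin.val_ofNat, Nat.mod_eq_of_lt (by omega)]; simp
    have e4 : Fin.last n ≠ 0 := by
      rw [Ne, Fin.ext_iff]; simp; omega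
    rw [eval_pderiv_quadric, ha0, e1]
    simp only [if_neg e2, if_neg e3, if_neg e4]
    simp
  refine ⟨curveCone A, isNormalRationalCurve_iff.2 ⟨A, hA, rfl⟩, ?_, ?_⟩
  · intro m F _ hFΓ
    obtain ⟨e, he, -⟩ := exists_aeval_eq_add (by omega) hz' F
    rw [ParamArc.VanishesToOrder, he, aeval_rationalArc (by omega) hFΓ, zero_add]
    exact dvd_mul_right _ _
  · intro v hv
    have hq := quadric_mem_vanishingIdeal hBA (show 0 < n by omega) (show n - 1 < n by omega)
    -- Since `d` lies in the osculating hyperplane, this quadric contains the thick point of length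
    -- `n + 4`, so its differential annihilates the principal plane.
    have h3 := hv 2 _ (quadric_isHomogeneous _ 0 (n - 1)) hq (by
      obtain ⟨e, he, he'⟩ := exists_aeval_eq_add (by omega) hz' (quadric A⁻¹ 0 (n - 1))
      simp only [constantCoeff_rationalArc_eq (by omega) hz'] at he'
      have h4 : (fun i => constantCoeff (a.series i)) = a.vec 0 := by
        ext i; simp [ParamArc.vec]
      rw [h4] at he'
      change _ = ∑ k, _ * d k at he'
      rw [hlam, hd, mul_zero] at he'
      rw [ParamArc.VanishesToOrder, he, aeval_rationalArc (by omega) hq, zero_add, pow_succ]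
      exact mul_dvd_mul_left _ (X_dvd_iff.2 he'))
    rw [hlam] at h3
    refine a.mem_osculatingHyperplane hU ?_
    rw [hμ, (mul_eq_zero.1 h3).resolve_left hg, mul_zero]

end PrincipalPlane

/-! ### Divisibility by the Monge polynomial. -/

section Divisibility

open MvPolynomial

lemma notMem_vars_of_dvd {σ : Type*} {p q : MvPolynomial σ ℂ} (h : p ∣ q) (hq : q ≠ 0) {s : σ}
    (hs : s ∉ q.vars) : s ∉ p.vars := by
  classical
  obtain ⟨r, rfl⟩ := h
  rw [vars_def, Multiset.mem_toFinset, ← Multiset.count_eq_zero, ← degreeOf_def] at hs ⊢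
  rw [degreeOf_mul_eq (left_ne_zero_of_mul hq) (right_ne_zero_of_mul hq)] at hs
  omega

/-- The substitution of `0` for one variable. -/
def killVar {σ : Type*} [DecidableEq σ] (s : σ) : MvPolynomial σ ℂ →ₐ[ℂ] MvPolynomial σ ℂ :=
  bind₁ fun t => if t = s then 0 else X t

lemma notMem_vars_killVar {σ : Type*} [DecidableEq σ] (s : σ) (p : MvPolynomial σ ℂ) :
    s ∉ (killVar s p).vars := by
  intro h
  obtain ⟨t, -, ht⟩ := mem_vars_bind₁ _ _ h
  split_ifs at ht with hts
  · simp at ht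
  · rw [vars_X, Finset.mem_singleton] at ht
    exact hts ht.symm

lemma notMem_vars_of_killVar_eq {σ : Type*} [DecidableEq σ] {s : σ} {p : MvPolynomial σ ℂ}
    (h : killVar s p = p) : s ∉ p.vars :=
  h ▸ notMem_vars_killVar s p

/-- Pseudo-division by a polynomial that is linear in one of the variables. -/
lemma exists_dvd_pow_mul_sub {σ : Type*} {s : σ} {A B : MvPolynomial σ ℂ} (hA : s ∉ A.vars)
    (hB : s ∉ B.vars) (f : MvPolynomial σ ℂ) :
    ∃ (k : ℕ) (r : MvPolynomial σ ℂ), s ∉ r.vars ∧ A * X s + B ∣ A ^ k * f - r := by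
  have hmem : ∀ p : MvPolynomial σ ℂ, s ∉ p.vars ↔ p ∈ supported ℂ ({s}ᶜ : Set σ) := fun p => by
    rw [mem_supported, Set.subset_compl_singleton_iff, Finset.mem_coe]
  rw [hmem] at hA hB
  simp only [hmem]
  induction f using MvPolynomial.induction_on with
  | C c => exact ⟨0, C c, Subalgebra.algebraMap_mem _ c, by simp⟩
  | add p q hp hq =>
    obtain ⟨k, r, hr, hk⟩ := hp
    obtain ⟨l, t, ht, hl⟩ := hq
    refine ⟨k + l, A ^ l * r + A ^ k * t, add_mem (mul_mem (pow_mem hA _) hr)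
      (mul_mem (pow_mem hA _) ht), ?_⟩
    have : A ^ (k + l) * (p + q) - (A ^ l * r + A ^ k * t) =
        A ^ l * (A ^ k * p - r) + A ^ k * (A ^ l * q - t) := by ring
    rw [this]
    exact dvd_add (dvd_mul_of_dvd_right hk _) (dvd_mul_of_dvd_right hl _)
  | mul_X p t hp =>
    obtain ⟨k, r, hr, hk⟩ := hp
    by_cases hts : t = s
    · subst hts
      refine ⟨k + 1, -(B * r), neg_mem (mul_mem hB hr), ?_⟩
      have : A ^ (k + 1) * (p * X t) - -(B * r) =
          A * X t * (A ^ k * p - r) + r * (A * X t + B) := by ring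
      rw [this]
      exact dvd_add (dvd_mul_of_dvd_right hk _) (dvd_mul_left _ _)
    · refine ⟨k, r * X t, mul_mem hr (X_mem_supported.2 hts), ?_⟩
      rw [show A ^ k * (p * X t) - r * X t = X t * (A ^ k * p - r) by ring]
      exact dvd_mul_of_dvd_right hk _

/-- Where `A ≠ 0`, the equation can be solved for the variable `s`. The pseudo-remainder does not
involve `s`, hence vanishes wherever `A` does not, and so is zero. -/
lemma exists_dvd_pow_mul {σ : Type*} {s : σ} {A B f : MvPolynomial σ ℂ} (hA : s ∉ A.vars)
    (hB : s ∉ B.vars) (hA0 : A ≠ 0)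
    (hf : ∀ x : σ → ℂ, eval x A ≠ 0 → eval x (A * X s + B) = 0 → eval x f = 0) :
    ∃ k : ℕ, A * X s + B ∣ A ^ k * f := by
  classical
  obtain ⟨k, r, hr, hk⟩ := exists_dvd_pow_mul_sub hA hB f
  suffices h : A * r = 0 by
    rw [(mul_eq_zero.1 h).resolve_left hA0, sub_zero] at hk
    exact ⟨k, hk⟩
  refine MvPolynomial.funext fun x => ?_
  rw [map_mul, map_zero, mul_eq_zero, or_iff_not_imp_left]
  intro hx
  have hup : ∀ (c : ℂ) {p : MvPolynomial σ ℂ}, s ∉ p.vars →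
      eval (Function.update x s c) p = eval x p := fun c p hp =>
    eval₂Hom_congr' rfl (fun i hi _ => Function.update_of_ne (fun h => hp (by rwa [← h])) _ _) rfl
  set y := Function.update x s (-eval x B / eval x A) with hy
  have hFy : eval y (A * X s + B) = 0 := by
    rw [map_add, map_mul, hup _ hA, hup _ hB, eval_X, hy, Function.update_self]
    field_simp
    ring
  obtain ⟨q, hq⟩ := hk
  have := congrArg (eval y) hq
  rw [map_mul, hFy, zero_mul, map_sub, map_mul, hf y (by rwa [hup _ hA]) hFy, mul_zero, zero_sub,
    neg_eq_zero, hup _ hr] at this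
  exact this

variable {n : ℕ}

/-- The generic sequence of vectors. -/
def genericVec (n : ℕ) (j : ℕ) (i : Fin (n + 1)) : CoordRing n := X (i, j)

lemma mongePolynomial_eq (n : ℕ) : mongePolynomial n = mongeForm (genericVec n) := rfl

lemma eval_mongePolynomial (x : Fin (n + 1) × ℕ → ℂ) :
    eval x (mongePolynomial n) = mongeForm fun j i => x (i, j) := by
  rw [mongePolynomial_eq, mongeForm_map]
  simp [genericVec]

lemma eval_pluecker_genericVec (x : Fin (n + 1) × ℕ → ℂ) (l : List ℕ) :
    eval x (pluecker (genericVec n) l) = pluecker (fun j i => x (i, j)) l := by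
  rw [pluecker_map]
  simp [genericVec]

lemma lastMinor_single {R : Type*} [CommRing R] (v : ℕ → Fin (n + 1) → R) (k : Fin (n + 1)) :
    lastMinor v (Pi.single k 1) = (-1) ^ ((k : ℕ) + n) *
      Matrix.det (Matrix.of fun i j : Fin n => v j (k.succAbove i)) := by
  rw [lastMinor_apply, Matrix.det_succ_column _ (Fin.last n), Finset.sum_eq_single k]
  · have : ((Matrix.of fun i j : Fin (n + 1) => if (j : ℕ) = n then
        (Pi.single k 1 : Fin (n + 1) → R) i else v j i).submatrix k.succAbove
          (Fin.last n).succAbove) = Matrix.of fun i j : Fin n => v j (k.succAbove i) := by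
      ext i j
      simp [j.2.ne]
    rw [this]
    simp
  · intro i _ hi
    simp [hi]
  · simp

lemma lastMinor_genericVec_single_ne_zero (k : Fin (n + 1)) :
    lastMinor (genericVec n) (Pi.single k 1) ≠ 0 := by
  rw [lastMinor_single]
  refine mul_ne_zero (pow_ne_zero _ (by simp)) fun h => ?_
  have := congrArg (eval fun p : Fin (n + 1) × ℕ =>
    if h : p.2 < n then (if p.1 = k.succAbove ⟨p.2, h⟩ then (1 : ℂ) else 0) else 0) h
  rw [RingHom.map_det, map_zero] at this
  refine one_ne_zero (α := ℂ) ?_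
  rw [← this, ← Matrix.det_one (n := Fin n)]
  congr 1
  ext i j
  simp [genericVec, Matrix.one_apply]

lemma killVar_genericVec (s : Fin (n + 1) × ℕ) (j : ℕ) (i : Fin (n + 1)) :
    killVar s (genericVec n j i) = if (i, j) = s then 0 else genericVec n j i := by
  rw [killVar, genericVec, bind₁_X_right]

lemma killVar_lastMinor (s : Fin (n + 1) × ℕ) (x : Fin (n + 1) → CoordRing n) :
    killVar s (lastMinor (genericVec n) x) =
      lastMinor (fun j i => if (i, j) = s then 0 else genericVec n j i)
        (fun i => killVar s (x i)) := by
  rw [← RingHom.coe_coe, lastMinor_map]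
  simp only [RingHom.coe_coe, killVar_genericVec]

lemma notMem_vars_lastMinor_single {k i : Fin (n + 1)} {j : ℕ} (h : n ≤ j ∨ i = k) :
    (i, j) ∉ (lastMinor (genericVec n) (Pi.single k 1)).vars := by
  refine notMem_vars_of_killVar_eq ?_
  have : (fun l => killVar (i, j) ((Pi.single k 1 : Fin (n + 1) → CoordRing n) l)) =
      Pi.single k 1 := by
    ext1 l
    by_cases hl : l = k
    · subst hl; simp
    · simp [hl]
  rw [killVar_lastMinor, this, lastMinor_single, lastMinor_single]
  congr 2
  ext1 a b
  rw [Matrix.of_apply, Matrix.of_apply, if_neg]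
  rintro hab
  obtain ⟨h1, h2⟩ := Prod.ext_iff.1 hab
  rcases h with h | h
  · have := b.2
    simp only at h2
    omega
  · exact Fin.succAbove_ne k a (h1.trans h)

lemma notMem_vars_lastMinor_genericVec {m j : ℕ} (hj : n ≤ j) (hm : m ≠ j) (i : Fin (n + 1)) :
    (i, j) ∉ (lastMinor (genericVec n) (genericVec n m)).vars := by
  refine notMem_vars_of_killVar_eq ?_
  rw [killVar_lastMinor]
  congr 1
  · rw [lastMinor_congr]
    intro b hb
    ext1 a
    rw [if_neg]
    simp only [Prod.mk.injEq]
    omega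
  · ext1 a
    rw [killVar_genericVec, if_neg]
    simp [hm]

/-- The substitution of a vector for one of the vectors of the generic sequence. -/
def substVec (m : ℕ) (w : Fin (n + 1) → CoordRing n) : CoordRing n →ₐ[ℂ] CoordRing n :=
  bind₁ fun p => if p.2 = m then w p.1 else X p

lemma substVec_genericVec (m : ℕ) (w : Fin (n + 1) → CoordRing n) (j : ℕ) (i : Fin (n + 1)) :
    substVec m w (genericVec n j i) = if j = m then w i else genericVec n j i := by
  rw [substVec, genericVec, bind₁_X_right]

lemma substVec_eq_self {m : ℕ} (w : Fin (n + 1) → CoordRing n) {p : CoordRing n}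
    (hp : ∀ i, (i, m) ∉ p.vars) : substVec m w p = p := by
  conv_rhs => rw [← AlgHom.id_apply (R := ℂ) p]
  rw [← RingHom.coe_coe, ← RingHom.coe_coe (AlgHom.id ℂ _)]
  refine hom_congr_vars (by ext; simp [substVec]) (fun s hs _ => ?_) rfl
  have : s.2 ≠ m := by
    rintro rfl
    exact hp s.1 hs
  simp [substVec, this]

lemma substVec_lastMinor {m : ℕ} (hm : n ≤ m) (w : Fin (n + 1) → CoordRing n) :
    substVec m w (lastMinor (genericVec n) (genericVec n m)) = lastMinor (genericVec n) w := by
  rw [← RingHom.coe_coe, lastMinor_map]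
  simp only [RingHom.coe_coe, substVec_genericVec, if_true]
  rw [lastMinor_congr]
  intro j hj
  ext1 i
  rw [if_neg (by omega)]

/-- Substituting a basis vector for the vector of index `m` leaves `p` unchanged. -/
lemma dvd_lastMinor_single {p : CoordRing n} {m : ℕ} (hm : n ≤ m) (hp : ∀ i, (i, m) ∉ p.vars)
    (h : p ∣ lastMinor (genericVec n) (genericVec n m)) (k : Fin (n + 1)) :
    p ∣ lastMinor (genericVec n) (Pi.single k 1) := by
  have := map_dvd (substVec m (Pi.single k 1)) h
  rwa [substVec_eq_self _ hp, substVec_lastMinor hm] at this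

lemma lastMinor_genericVec_ne_zero {m : ℕ} (hm : n ≤ m) :
    lastMinor (genericVec n) (genericVec n m) ≠ 0 := fun h =>
  lastMinor_genericVec_single_ne_zero (0 : Fin (n + 1)) <| by
    rw [← substVec_lastMinor hm, h, map_zero]

/-- The `k`-th minor contains no variable from row `k`, so a common divisor contains no variable at
all. -/
lemma isUnit_of_dvd_lastMinor_single {p : CoordRing n}
    (h : ∀ k, p ∣ lastMinor (genericVec n) (Pi.single k 1)) : IsUnit p := by
  have hv : p.vars = ∅ := by
    refine Finset.eq_empty_of_forall_notMem fun s => ?_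
    exact notMem_vars_of_dvd (h s.1) (lastMinor_genericVec_single_ne_zero _)
      (notMem_vars_lastMinor_single (Or.inr rfl))
  rw [vars_eq_empty_iff_eq_C] at hv
  have h0 : p ≠ 0 := ne_zero_of_dvd_ne_zero (lastMinor_genericVec_single_ne_zero 0) (h 0)
  rw [hv] at h0 ⊢
  exact (isUnit_iff_ne_zero.2 fun hc => h0 (by rw [hc, map_zero])).map C

/-- A common prime factor `p` would divide all the minors of `a₀, …, aₙ₋₁`. If `p ∣ U`, then `p ∣
U₁`, which does not involve `aₙ`, and basis vectors are substituted for `aₙ` in `U`. Otherwise,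
varying `a_{n+3}` in the Monge polynomial shows that `p` divides `U²` times each minor. -/
lemma isRelPrime_mongePolynomial :
    IsRelPrime (pluecker (genericVec n) [] ^ 2 * lastMinor (genericVec n) (Pi.single 0 1))
      (mongePolynomial n) := by
  have hU0 : pluecker (genericVec n) [] ≠ 0 := by
    rw [pluecker_nil]
    exact lastMinor_genericVec_ne_zero le_rfl
  have hUv : ∀ i j, n < j → (i, j) ∉ (pluecker (genericVec n) []).vars := fun i j hj => by
    rw [pluecker_nil]
    exact notMem_vars_lastMinor_genericVec hj.le hj.ne i
  have hA0 := mul_ne_zero (pow_ne_zero 2 hU0)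
    (lastMinor_genericVec_single_ne_zero (0 : Fin (n + 1)))
  rw [UniqueFactorizationMonoid.isRelPrime_iff_no_prime_factors hA0]
  intro p hpA hpF hp
  have hpv : ∀ i, (i, n + 3) ∉ p.vars := fun i => by
    rcases hp.dvd_mul.1 hpA with h | h
    · exact notMem_vars_of_dvd (hp.dvd_of_dvd_pow h) hU0 (hUv _ _ (by omega))
    · exact notMem_vars_of_dvd h (lastMinor_genericVec_single_ne_zero _)
        (notMem_vars_lastMinor_single (Or.inl (by omega)))
  refine hp.not_isUnit (isUnit_of_dvd_lastMinor_single fun k => ?_)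
  by_cases hpU : p ∣ pluecker (genericVec n) []
  · have hpU1 : p ∣ pluecker (genericVec n) [1] := by
      have h1 : p ∣ (2 : CoordRing n) * pluecker (genericVec n) [1] ^ 3 := by
        have h2 : (2 : CoordRing n) * pluecker (genericVec n) [1] ^ 3 = mongePolynomial n -
          pluecker (genericVec n) [] * (pluecker (genericVec n) [] * (pluecker (genericVec n) [3] +
            2 * pluecker (genericVec n) [2, 1] + pluecker (genericVec n) [1, 1, 1]) -
            3 * pluecker (genericVec n) [1] * (pluecker (genericVec n) [1, 1] +
              pluecker (genericVec n) [2])) := by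
          rw [mongePolynomial_eq, mongeForm]; ring
        rw [h2]
        exact dvd_sub hpF (dvd_mul_of_dvd_left hpU _)
      refine hp.dvd_of_dvd_pow ((hp.dvd_mul.1 h1).resolve_left fun h2 => hp.not_isUnit ?_)
      refine isUnit_of_dvd_unit h2 ?_
      rw [← map_ofNat (C (σ := Fin (n + 1) × ℕ) (R := ℂ)) 2]
      exact (isUnit_iff_ne_zero.2 two_ne_zero).map C
    rw [pluecker_singleton] at hpU1
    rw [pluecker_nil] at hpU
    refine dvd_lastMinor_single le_rfl (fun i => ?_) hpU k
    exact notMem_vars_of_dvd hpU1 (lastMinor_genericVec_ne_zero (by omega))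
      (notMem_vars_lastMinor_genericVec le_rfl (by omega) i)
  · have key : ∀ w : Fin (n + 1) → CoordRing n,
        substVec (n + 3) w (mongePolynomial n) = mongePolynomial n +
          pluecker (genericVec n) [] ^ 2 * lastMinor (genericVec n) (w - genericVec n (n + 3)) :=
      fun w => by
        rw [mongePolynomial_eq, ← RingHom.coe_coe, mongeForm_map]
        simp only [RingHom.coe_coe, substVec_genericVec]
        rw [mongeForm_eq_add (v := genericVec n)]
        · simp only [if_true]
        · intro j hj
          ext1 i
          rw [if_neg (by omega)]
    have h1 : ∀ w, p ∣ substVec (n + 3) w (mongePolynomial n) := fun w => by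
      have := map_dvd (substVec (n + 3) w) hpF
      rwa [substVec_eq_self _ hpv] at this
    have h2 := dvd_sub (h1 (Pi.single k 1)) (h1 0)
    rw [key, key, add_sub_add_left_eq_sub, ← mul_sub, ← map_sub, sub_sub_sub_cancel_right,
      sub_zero] at h2
    exact (hp.dvd_mul.1 h2).resolve_left fun h => hpU (hp.dvd_of_dvd_pow h)

/-- A polynomial that vanishes where the Monge polynomial does and `U` does not is divisible by the
Monge polynomial. -/
theorem mongePolynomial_dvd {f : CoordRing n}
    (hf : ∀ x : Fin (n + 1) × ℕ → ℂ, pluecker (fun j i => x (i, j)) [] ≠ 0 →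
      (mongeForm fun j i => x (i, j)) = 0 → eval x f = 0) : mongePolynomial n ∣ f := by
  set s : Fin (n + 1) × ℕ := (0, n + 3) with hs
  set A := pluecker (genericVec n) [] ^ 2 * lastMinor (genericVec n) (Pi.single 0 1) with hA
  set w : ℕ → Fin (n + 1) → CoordRing n := fun j i => killVar s (genericVec n j i) with hw
  have hB : killVar s (mongePolynomial n) = mongeForm w := by
    rw [mongePolynomial_eq, ← RingHom.coe_coe, mongeForm_map]
    simp only [RingHom.coe_coe, hw]
  have hwj : ∀ j < n + 3, genericVec n j = w j := fun j hj => by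
    ext1 i
    rw [hw]
    simp only [killVar_genericVec]
    rw [if_neg]
    simp [hs, hj.ne]
  -- Setting the variable `s` to zero changes only the vector of index `n + 3`, by `X s` times the
  -- first basis vector.
  have hdec : mongePolynomial n = A * X s + killVar s (mongePolynomial n) := by
    have h1 : genericVec n (n + 3) - w (n + 3) = (X s : CoordRing n) • Pi.single 0 1 := by
      ext1 i
      by_cases hi : i = 0
      · subst hi; simp [hw, killVar, hs, genericVec]
      · simp [hw, killVar_genericVec, hs, hi]
    rw [hB, mongePolynomial_eq, mongeForm_eq_add hwj, h1, map_smul, hA, pluecker_nil, pluecker_nil,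
      lastMinor_congr fun j hj => hwj j (by omega), hwj n (by omega), smul_eq_mul]
    ring
  have hU0 : pluecker (genericVec n) [] ≠ 0 := by
    rw [pluecker_nil]
    exact lastMinor_genericVec_ne_zero le_rfl
  have hAs : s ∉ A.vars := by
    intro h
    rcases Finset.mem_union.1 (vars_mul _ _ h) with h | h
    · rw [pluecker_nil] at h
      exact notMem_vars_lastMinor_genericVec (by omega) (by omega) _ (vars_pow _ _ h)
    · exact notMem_vars_lastMinor_single (Or.inl (by omega)) h
  have hA0 : A ≠ 0 :=
    mul_ne_zero (pow_ne_zero 2 hU0) (lastMinor_genericVec_single_ne_zero 0)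
  obtain ⟨k, hk⟩ := exists_dvd_pow_mul (f := f) hAs (notMem_vars_killVar s (mongePolynomial n)) hA0
    fun x hx hFx => by
      rw [← hdec, eval_mongePolynomial] at hFx
      refine hf x (fun h => hx ?_) hFx
      rw [hA, map_mul, map_pow, eval_pluecker_genericVec, h]
      simp
  rw [← hdec] at hk
  have hrel : IsRelPrime (mongePolynomial n) (A ^ k) := isRelPrime_mongePolynomial.symm.pow_right
  exact hrel.dvd_of_dvd_mul_left hk

end Divisibility

/-! ### The closure in the space of arcs. -/

section Closure

variable {n : ℕ}

lemma ParamArc.eval_mongePolynomial (a : ParamArc n) :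
    a.eval (mongePolynomial n) = mongeForm a.vec :=
  Monge.eval_mongePolynomial _

/-- The parametrised arc with given coefficients. -/
def paramArcOfPluecker (hn : n ≠ 0) (x : Fin (n + 1) × ℕ → ℂ)
    (hx : pluecker (fun j i => x (i, j)) [] ≠ 0) : ParamArc n where
  series i := PowerSeries.mk fun j => x (i, j)
  smooth := by
    rw [pluecker_nil', ← isUnit_iff_ne_zero, ← Matrix.isUnit_iff_isUnit_det,
      ← Matrix.linearIndependent_cols_iff_isUnit] at hx
    have hinj : Function.Injective ![(⟨0, by omega⟩ : Fin (n + 1)), ⟨1, by omega⟩] := by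
      intro k l h
      fin_cases k <;> fin_cases l <;> simp at h ⊢
    have h := hx.comp _ hinj
    have heq : (Matrix.of fun i j : Fin (n + 1) => x (i, (j : ℕ))).col ∘
        ![(⟨0, by omega⟩ : Fin (n + 1)), ⟨1, by omega⟩] =
        ![fun i => PowerSeries.coeff 0 (PowerSeries.mk fun j => x (i, j)),
          fun i => PowerSeries.coeff 1 (PowerSeries.mk fun j => x (i, j))] := by
      ext k i
      fin_cases k <;> simp [Matrix.col] <;> rfl
    rw [heq] at h
    exact h

lemma paramArcOfPluecker_vec (hn : n ≠ 0) (x : Fin (n + 1) × ℕ → ℂ)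
    (hx : pluecker (fun j i => x (i, j)) [] ≠ 0) :
    (paramArcOfPluecker hn x hx).vec = fun j i => x (i, j) := by
  ext j i
  simp [ParamArc.vec, paramArcOfPluecker]

/-- The basic open sets of the Zariski topology. -/
lemma ParamArc.exists_eval_ne_zero_subset {V : Set (ParamArc n)} (hV : IsOpen V) {a : ParamArc n}
    (ha : a ∈ V) : ∃ f : CoordRing n, a.eval f ≠ 0 ∧ ∀ b : ParamArc n, b.eval f ≠ 0 → b ∈ V := by
  change TopologicalSpace.GenerateOpen _ V at hV
  induction hV with
  | basic s hs =>
    obtain ⟨f, rfl⟩ := hs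
    exact ⟨f, ha, fun b hb => hb⟩
  | univ => exact ⟨1, by simp [ParamArc.eval], fun b _ => trivial⟩
  | inter s t _ _ ihs iht =>
    obtain ⟨f, hf, hf'⟩ := ihs ha.1
    obtain ⟨g, hg, hg'⟩ := iht ha.2
    refine ⟨f * g, ?_, fun b hb => ?_⟩
    · simpa [ParamArc.eval] using And.intro hf hg
    · have : b.eval f ≠ 0 ∧ b.eval g ≠ 0 := by simpa [ParamArc.eval] using hb
      exact ⟨hf' b this.1, hg' b this.2⟩
  | sUnion S _ ih =>
    obtain ⟨s, hs, has⟩ := ha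
    obtain ⟨f, hf, hf'⟩ := ih s hs has
    exact ⟨f, hf, fun b hb => ⟨s, hs, hf' b hb⟩⟩

/-- By invariance the vanishing of the polynomial defines a subset of the orbit space, closed
because its complement pulls back to a basic open set. -/
lemma mongeHypersurface_subset (hn : 2 ≤ n) {a : ParamArc n}
    (ha : Arc.mk a ∈ mongeHypersurface n) : mongeForm a.vec = 0 := by
  set Z : Set (Arc n) := {α | Quot.lift (fun a : ParamArc n => mongeForm a.vec = 0)
    (fun a b h => propext (mongeForm_eq_zero_iff_of_sameArc hn h)) α} with hZ
  have hclosed : IsClosed Z := by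
    rw [← isOpen_compl_iff]
    change IsOpen (Quot.mk (SameArc (n := n)) ⁻¹' Zᶜ)
    refine TopologicalSpace.isOpen_generateFrom_of_mem ⟨mongePolynomial n, ?_⟩
    ext b
    rw [Set.mem_ofPred_eq, b.eval_mongePolynomial]
    rfl
  refine closure_minimal (t := Z) ?_ hclosed ha
  rintro _ ⟨b, rfl, -, Γ, hΓ, hthick, hle⟩
  exact mongeForm_eq_zero_of_principalPlane_le hn b hΓ hthick hle

lemma mem_mongeHypersurface (hn : 2 ≤ n) {a : ParamArc n} (ha : mongeForm a.vec = 0) :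
    Arc.mk a ∈ mongeHypersurface n := by
  refine mem_closure_iff.2 fun V hV haV => ?_
  have hV' : IsOpen (Quot.mk (SameArc (n := n)) ⁻¹' V) := hV
  obtain ⟨f, hf, hfV⟩ := ParamArc.exists_eval_ne_zero_subset hV' haV
  obtain ⟨x, hU, hF, hfx⟩ : ∃ x : Fin (n + 1) × ℕ → ℂ, pluecker (fun j i => x (i, j)) [] ≠ 0 ∧
      (mongeForm fun j i => x (i, j)) = 0 ∧ MvPolynomial.eval x f ≠ 0 := by
    -- If the basic open set of `f` missed every non-inflexional zero of the Monge polynomial, then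
    -- `f` would be a multiple of it and vanish at `a`.
    by_contra! h
    obtain ⟨q, rfl⟩ := mongePolynomial_dvd h
    refine hf ?_
    rw [ParamArc.eval, map_mul, ← ParamArc.eval, a.eval_mongePolynomial, ha, zero_mul]
  set b := paramArcOfPluecker (by omega) x hU
  have hb : b.vec = fun j i => x (i, j) := paramArcOfPluecker_vec _ _ _
  rw [← hb] at hU hF
  refine ⟨Arc.mk b, hfV b ?_, b, rfl, b.nonInflexional_iff.2 hU,
    exists_principalPlane_le hn b hU hF⟩
  rwa [ParamArc.eval, hb]

end Closure

end Monge

end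

/-- The Monge hypersurface has equation
`U² (U₃ + 2 U₂₁ + U₁₁₁) - 3 U U₁ (U₁₁ + U₂) + 2 U₁³ = 0` in every dimension `n ≥ 2`: it is the zero
locus of this polynomial, which moreover generates the ideal of the hypersurface. -/
theorem mainTheorem1 (n : ℕ) (hn : 2 ≤ n) :
    (∀ a : Monge.ParamArc n,
      Monge.Arc.mk a ∈ Monge.mongeHypersurface n ↔ a.eval (Monge.mongePolynomial n) = 0) ∧
    (∀ f : Monge.CoordRing n,
      (∀ a : Monge.ParamArc n, Monge.Arc.mk a ∈ Monge.mongeHypersurface n → a.eval f = 0) ↔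
        Monge.mongePolynomial n ∣ f) := by
  have h1 : ∀ a : Monge.ParamArc n,
      Monge.Arc.mk a ∈ Monge.mongeHypersurface n ↔ a.eval (Monge.mongePolynomial n) = 0 :=
    fun a => by
      rw [a.eval_mongePolynomial]
      exact ⟨Monge.mongeHypersurface_subset hn, Monge.mem_mongeHypersurface hn⟩
  refine ⟨h1, fun f => ⟨fun hf => Monge.mongePolynomial_dvd fun x hU hF => ?_, ?_⟩⟩
  · have hb := Monge.paramArcOfPluecker_vec (by omega) x hU
    have := hf (Monge.paramArcOfPluecker (by omega) x hU)
      (Monge.mem_mongeHypersurface hn (by rwa [hb]))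
    rwa [Monge.ParamArc.eval, hb] at this
  · rintro ⟨q, rfl⟩ a ha
    rw [h1, Monge.ParamArc.eval] at ha
    rw [Monge.ParamArc.eval, map_mul, ha, zero_mul]
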